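/- For an integer $L\ge 1$ place red points $r_i=i-\tfrac12$ ($1\le i\le L$) and $L$ independent uniformly distributed blue points on the circle $\mathbb R/L\mathbb Z$ with its distance $d$. A matching is a bijection $\pi$ from red to blue points, of cost $\sum_i d(r_i,b_{\pi(i)})^2$ (periodic boundary conditions, critical density, $p=2$). Let $\pi_{\rm opt}$ be an optimal matching, $\varphi_i\in[-\tfrac L2,\tfrac L2)$ the displacement $b_{\pi_{\rm opt}(i)}-r_i$ modulo $L$, $\sigma_i=\varphi_i/|\varphi_i|$, $G_L(x,y)=\mathbb E[\sigma_x\sigma_y]$, and let $G_L(r)$ be the average of $G_L(x,y)$ over the pairs of red points with $d(r_x,r_y)=r$. Let $b_{(1)}\le\dots\le b_{(L)}$ be the ordered representatives of the blue points in $[0,L]$. For $s\in[0,1]$ let $i_L(s)=\min(\lfloor sL\rfloor+1,L)$. 1. For every $L$, almost surely the optimal matching is unique and is a cyclic shift: there is an integer $\ell\in[-\tfrac L2,\tfrac L2)$ such that $\pi_{\rm opt}$ matches the red point of index $i-\ell$ (mod $L$) to $b_{(i)}$ for all $i$. Put $\lambda_L=-\ell/\sqrt L$. 2. Let $B$ be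 a standard Brownian bridge on $[0,1]$ (a centred Gaussian process with covariance $\min(s,t)-st$ and almost surely continuous paths). Almost surely, $\lambda\mapsto\int_0^1|B(s)-\lambda|^2\,ds$ attains its minimum exactly at $\lambda=\int_0^1B(s)\,ds$. Let $\varphi(s)=B(s)-\int_0^1B(u)\,du$. For all $s_1,\dots,s_k\in[0,1]$, as $L\to\infty$, jointly in distribution, $$\Big(\big(L^{-1/2}(b_{(i_L(s_m))}-r_{i_L(s_m)})\big)_{m\le k},\ \lambda_L,\ \big(L^{-1/2}\varphi_{i_L(s_m)}\big)_{m\le k}\Big)\longrightarrow\Big((B(s_m))_{m\le k},\ \int_0^1B,\ (\varphi(s_m))_{m\le k}\Big).$$ The process $\varphi$ is a centred Gaussian process and, with $\tau=|t-s|$, $$\operatorname{cov}[\varphi(s),\varphi(t)]=\tfrac1{12}-\tfrac12\tau(1-\tau).$$ If $0<\tau<1$, then $\mathbb E\big[\tfrac{\varphi(s)}{|\varphi(s)|}\tfrac{\varphi(t)}{|\varphi(t)|}\big]=G_{\rm pbc}(\tau)$, where $$G_{\rm pbc}(\tau)=\frac2\pi\arctan\left(\frac{1-6\tau(1-\tau)}{\sqrt{12\,\tau(1-\tau)\,(1-3\tau(1-\tau))}}\right).$$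 3. The two-point function of the matching problem converges to $G_{\rm pbc}$: if $L_n\to\infty$ and $x_n,y_n\in\{1,\dots,L_n\}$ satisfy $|y_n-x_n|/L_n\to\tau\in(0,1)$, then $G_{L_n}(x_n,y_n)\to G_{\rm pbc}(\tau)$; and if $L_n\to\infty$ and integers $0\le r_n\le L_n/2$ satisfy $r_n/L_n\to\tau\in(0,\tfrac12]$, then $G_{L_n}(r_n)\to G_{\rm pbc}(\tau)$. 4. On $(0,1)$, $G_{\rm pbc}(\tau)=0$ if and only if $\tau=\overline\tau$ or $\tau=1-\overline\tau$, where $\overline\tau=\frac{3-\sqrt3}6$. -/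

import Mathlib

open MeasureTheory ProbabilityTheory Filter Topology

noncomputable section

namespace GridPoisson

/-! ### The periodic one-dimensional matching problem with `L` red and `L` blue points, `p = 2` -/

/-- The red points on the circle `ℝ / Lℤ`: the points of `[0, L]` with half-integer coordinate
(indices start from `0`). -/
def redPoint (L : ℕ) (i : Fin L) : ℝ := (i : ℝ) + 1 / 2

/-- The law of `L` independent blue points, each of them uniform on `[0, L]`. -/
def blueLaw (L : ℕ) : Measure (Fin L → ℝ) :=
  Measure.pi fun _ => (volume : Measure ℝ)[|Set.Icc 0 (L : ℝ)]

instance blueLaw_isProbabilityMeasure (L : ℕ) : IsProbabilityMeasure (blueLaw L) := by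
  have h : ∀ _i : Fin L, IsProbabilityMeasure ((volume : Measure ℝ)[|Set.Icc 0 (L : ℝ)]) := by
    intro i
    have hL : L ≠ 0 := i.pos.ne'
    refine cond_isProbabilityMeasure_of_finite ?_ ?_ <;> simp [hL]
  unfold blueLaw
  infer_instance

/-- The distance on the circle `ℝ / Lℤ`, i.e. `min_{ν ∈ ℤ} |y - x - ν L|`. -/
def circDist (L : ℕ) (x y : ℝ) : ℝ := ‖((y - x : ℝ) : AddCircle (L : ℝ))‖

/-- The cost (for `p = 2`) of the matching that sends the red point `i` to the blue point `π i`. -/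
def matchingCost (L : ℕ) (b : Fin L → ℝ) (π : Equiv.Perm (Fin L)) : ℝ :=
  ∑ i, circDist L (redPoint L i) (b (π i)) ^ 2

/-- `π` is a matching of minimal cost. -/
def IsOptimalMatching (L : ℕ) (b : Fin L → ℝ) (π : Equiv.Perm (Fin L)) : Prop :=
  ∀ π' : Equiv.Perm (Fin L), matchingCost L b π ≤ matchingCost L b π'

/-- An optimal matching; the choice matters only on a null set of blue configurations. -/
def optimalMatching (L : ℕ) (b : Fin L → ℝ) : Equiv.Perm (Fin L) :=
  (Finite.exists_min (matchingCost L b)).choose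

/-- The displacement vector from `x` to `y` on the circle `ℝ / Lℤ`: the representative of `y - x`
modulo `L` in `[-L/2, L/2)`. Its absolute value is `circDist L x y`. -/
def circDisplacement (L : ℕ) (x y : ℝ) : ℝ := y - x - round ((L : ℝ)⁻¹ * (y - x)) * L

/-- The displacement `φ_i` of the red point `i` in the optimal matching. -/
def displacement (L : ℕ) (b : Fin L → ℝ) (i : Fin L) : ℝ :=
  circDisplacement L (redPoint L i) (b (optimalMatching L b i))

/-- The spin `φ / |φ|` of a displacement `φ`. -/
def spin (x : ℝ) : ℝ := x / |x|

/-- The two-point function `G(x, y)`: the mean of `σ_x σ_y` over the blue points. -/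
def spinCorrelation (L : ℕ) (x y : Fin L) : ℝ :=
  ∫ b, spin (displacement L b x) * spin (displacement L b y) ∂(blueLaw L)

open Classical in
/-- The pairs of red points at distance `r` on the circle. -/
def pairsAtDist (L r : ℕ) : Finset (Fin L × Fin L) :=
  Finset.univ.filter fun q => circDist L (redPoint L q.1) (redPoint L q.2) = r

/-- The two-point function `G(r; L)` averaged over the pairs of red points at distance `r`. -/
def avgSpinCorrelation (L r : ℕ) : ℝ :=
  (∑ q ∈ pairsAtDist L r, spinCorrelation L q.1 q.2) / ((pairsAtDist L r).card : ℝ)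

/-- The `i`-th blue point in increasing order has label `Tuple.sort b i`. The optimal matching is
(almost surely) cyclic, `φ_{i - ℓ} = b_(i) - r_{i - ℓ}`; this is the integer `ℓ`, taken in
`[-L/2, L/2)`, and read off at the first red point. -/
def optimalShift (L : ℕ) (b : Fin L → ℝ) : ℤ :=
  if h : 0 < L then
    Int.bmod (((Tuple.sort b).symm (optimalMatching L b ⟨0, h⟩) : ℕ) : ℤ) L
  else 0

/-- The rescaled optimal shift. As `b_(i) - r_{i - ℓ} = (b_(i) - r_i) + ℓ` and the shifted process
is written `B - λ`, we have `λ = -ℓ / √L`. -/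
def scaledShift (L : ℕ) (b : Fin L → ℝ) : ℝ := -(optimalShift L b : ℝ) / √(L : ℝ)

/-- The step function on `[0, 1]` with value `f i / √L` on the `i`-th interval of length `1/L`. -/
def rescale (L : ℕ) (f : Fin L → ℝ) (s : unitInterval) : ℝ :=
  if h : 0 < L then
    f ⟨min ⌊(s : ℝ) * L⌋₊ (L - 1), by omega⟩ / √(L : ℝ)
  else 0

/-- The displacement of the `i`-th blue point (in increasing order) from the `i`-th red point. -/
def orderedDisplacement (L : ℕ) (b : Fin L → ℝ) (i : Fin L) : ℝ :=
  b (Tuple.sort b i) - redPoint L i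

/-! ### The continuum limit -/

/-- `B` is a standard Brownian bridge on `[0, 1]`: a centred Gaussian process with almost surely
continuous paths and covariance `min s t - s t`. -/
structure IsBrownianBridge {Ω : Type*} [MeasurableSpace Ω] (B : unitInterval → Ω → ℝ)
    (μ : Measure Ω) : Prop where
  isGaussianProcess : IsGaussianProcess B μ
  mean_eq_zero : ∀ s, ∫ ω, B s ω ∂μ = 0
  covariance_eq : ∀ s t : unitInterval,
    cov[B s, B t; μ] = min (s : ℝ) (t : ℝ) - (s : ℝ) * (t : ℝ)
  continuous_paths : ∀ᵐ ω ∂μ, Continuous fun s => B s ω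

/-- The cost `E[f - l] = ∫₀¹ |f(s) - l|² ds` of the path `f` translated by `l`. -/
def shiftEnergy (f : unitInterval → ℝ) (l : ℝ) : ℝ := ∫ s : unitInterval, |f s - l| ^ 2

/-- The mean `∫₀¹ f(s) ds` of a path. -/
def pathMean (f : unitInterval → ℝ) : ℝ := ∫ s : unitInterval, f s

/-- The process `φ(s) = B(s) - ∫₀¹ B`. -/
def centredProcess {Ω : Type*} (B : unitInterval → Ω → ℝ) (s : unitInterval) (ω : Ω) : ℝ :=
  B s ω - pathMean fun u => B u ω

/-- The function `G_pbc`. -/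
def Gpbc (τ : ℝ) : ℝ :=
  2 / Real.pi * Real.arctan
    ((1 - 6 * τ * (1 - τ)) / √(12 * τ * (1 - τ) * (1 - 3 * τ * (1 - τ))))

end GridPoisson

end

noncomputable section

namespace GridPoisson


/-! ### Quasi-periodic sequences -/

section Lift

variable (L : ℕ) [NeZero L]

/-! The circle is unrolled: red points, blue points and the partners chosen by a matching are
extended to quasi-periodic sequences on `ℤ`. For convex cost, two crossing partners can be exchanged
with profit, so the partners of an optimal matching form a strictly increasing sequence
(`strictMono_partnerLift`). It enumerates the same set as the sorted blue points, hence is a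
translate of them by an integer `q`. The optimal cost is `∑ (d_i + q)^2` with `d_i` the ordered
displacements, and cyclic shifts give competitors for every other integer, so `q` lies within `1/2`
of minus the mean of the `d_i` (`abs_liftShift_add_le`). Uniqueness holds because the cost
difference of two matchings, as a function of a suitable single blue point, has only countably many
zeros.

For the limit, all sizes are coupled through one sequence of uniform variables `u_j`, with blue
points `L * u_j`. The centred counting process `E(s) = ∑ bridgeKernel s (u_j)` is the empirical
bridge, extended periodically in `s`. Since `L s - E(s)` counts points, evaluating it at a blue
point gives an exact formula for each displacement in terms of `E` at a random argument. That
argument is within `O(1/√L)` of the index divided by `L`, with high probability. Monotonicity of `L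
s - E(s)` and a bounded number of Chebyshev estimates make `E` vary by only `o(√L)` there, so no
functional limit theorem is needed. The mean displacement is `∑ centredId (u_j)`. Thus, up to
`o(√L)` in probability, ordered displacements, minus the shift, and optimal displacements are the
sums over `u_j` of `bridgeKernel s`, `centredId` and their difference `sawtooth s`
(`exists_displacementApprox`).

The scalar central limit theorem and Cramér–Wold then reduce everything to variances. Under `B(s) ↔
bridgeKernel s`, `∫ B ↔ centredId`, `φ(s) ↔ sawtooth s`, linear functionals of the bridge are
centred Gaussian with variance equal to the squared `L²` norm of the corresponding kernel; the mean
of the path is reached through Riemann sums. The covariance of `φ` is thus an integral of sawtooth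
functions.

The sign correlation of a Gaussian pair is an angle computed in polar coordinates. It passes to the
limit because the product of signs is discontinuous only on the coordinate axes, a null set for the
limit law. Compactness of the positions makes the convergence uniform over pairs of points, which
yields the averaged statement. -/

/-- The index in `Fin L` of an integer modulo `L`. -/
def residue (m : ℤ) : Fin L :=
  ⟨(m % (L : ℤ)).toNat, by
    have h : (0 : ℤ) < L := by exact_mod_cast NeZero.pos L
    have h1 := Int.emod_nonneg m h.ne'
    have h2 := Int.emod_lt_of_pos m h
    omega⟩

lemma cast_pos_of_neZero : (0 : ℤ) < L := by exact_mod_cast NeZero.pos L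

lemma realCast_pos_of_neZero : (0 : ℝ) < L := by exact_mod_cast NeZero.pos L

lemma residue_val (m : ℤ) : ((residue L m : ℕ) : ℤ) = m % (L : ℤ) := by
  have h1 := Int.emod_nonneg m (cast_pos_of_neZero L).ne'
  simp only [residue]
  omega

lemma residue_eq_iff (m m' : ℤ) : residue L m = residue L m' ↔ m % (L : ℤ) = m' % (L : ℤ) := by
  rw [← residue_val, ← residue_val, Fin.ext_iff]
  omega

@[simp] lemma residue_natCast (j : Fin L) : residue L ((j : ℕ) : ℤ) = j := by
  ext
  have := residue_val L ((j : ℕ) : ℤ)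
  rw [Int.emod_eq_of_lt (by positivity) (by exact_mod_cast j.isLt)] at this
  omega

lemma residue_add_mul (m k : ℤ) : residue L (m + k * L) = residue L m := by
  rw [residue_eq_iff]; simp

/-- The quasi-periodic extension of `f` to the integers: `f (i + k L) = f i + k L`. -/
def periodicLift (f : Fin L → ℝ) (m : ℤ) : ℝ := f (residue L m) + ((m / (L : ℤ) : ℤ) : ℝ) * L

variable {L}

lemma periodicLift_natCast (f : Fin L → ℝ) (j : Fin L) : periodicLift L f ((j : ℕ) : ℤ) = f j := by
  have : ((j : ℕ) : ℤ) / (L : ℤ) = 0 :=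
    Int.ediv_eq_zero_of_lt (by positivity) (by exact_mod_cast j.isLt)
  simp [periodicLift, this]

lemma periodicLift_add_mul (f : Fin L → ℝ) (m k : ℤ) :
    periodicLift L f (m + k * L) = periodicLift L f m + k * L := by
  rw [periodicLift, periodicLift, residue_add_mul,
    Int.add_mul_ediv_right _ _ (cast_pos_of_neZero L).ne']
  push_cast; ring

lemma eq_residue_add (m : ℤ) : m = ((residue L m : ℕ) : ℤ) + (m / (L : ℤ)) * L := by
  rw [residue_val]
  have := Int.emod_add_mul_ediv m L
  linarith

lemma periodicLift_redPoint (m : ℤ) : periodicLift L (redPoint L) m = m + 1 / 2 := by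
  have h := congrArg (fun z : ℤ => (z : ℝ)) (eq_residue_add (L := L) m)
  simp only [periodicLift, redPoint]
  push_cast at h
  linarith

/-- The cyclic shift by `q`. -/
def cyclicShift (L : ℕ) [NeZero L] (q : ℤ) : Equiv.Perm (Fin L) where
  toFun j := residue L ((j : ℕ) + q)
  invFun j := residue L ((j : ℕ) - q)
  left_inv j := by
    conv_rhs => rw [← residue_natCast L j]
    rw [residue_eq_iff, residue_val]
    simp [Int.emod_sub_emod]
  right_inv j := by
    conv_rhs => rw [← residue_natCast L j]
    rw [residue_eq_iff, residue_val]
    simp [Int.emod_add_emod]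

lemma cyclicShift_apply (q : ℤ) (j : Fin L) : cyclicShift L q j = residue L ((j : ℕ) + q) := rfl

/-- Since the values lie in the open interval `(0, L)`, successive translates by `L` occupy
disjoint, ordered blocks. -/
lemma strictMono_periodicLift_of_bounds {f : Fin L → ℝ} (hf : StrictMono f)
    (hb : ∀ i, f i ∈ Set.Ioo 0 (L : ℝ)) : StrictMono (periodicLift L f) := by
  intro m m' h
  have hL := realCast_pos_of_neZero L
  have h1 := eq_residue_add (L := L) m
  have h2 := eq_residue_add (L := L) m'
  have hr : (residue L m : ℕ) < L := (residue L m).isLt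
  have hr' : (residue L m' : ℕ) < L := (residue L m').isLt
  rcases lt_trichotomy (m / (L : ℤ)) (m' / (L : ℤ)) with hlt | heq | hgt
  · have : ((m / (L : ℤ) : ℤ) : ℝ) + 1 ≤ ((m' / (L : ℤ) : ℤ) : ℝ) := by exact_mod_cast hlt
    simp only [periodicLift]
    nlinarith [(hb (residue L m)).2, (hb (residue L m')).1]
  · simp only [periodicLift, heq]
    have : residue L m < residue L m' := by
      rw [Fin.lt_def]; rw [heq] at h1; omega
    linarith [hf this]
  · exfalso
    have : m' / (L : ℤ) ≤ m / (L : ℤ) := hgt.le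
    exact absurd (Int.ediv_le_ediv (cast_pos_of_neZero L) h.le) (by omega)

end Lift

/-- Surjectivity forbids gaps: the preimage of `f m + 1` lies beyond `m`, so `f (m + 1)` cannot
exceed `f m + 1`. -/
lemma StrictMono.int_eq_add {f : ℤ → ℤ} (hf : StrictMono f) (hs : Function.Surjective f) (m : ℤ) :
    f m = m + f 0 := by
  have step : ∀ m, f (m + 1) = f m + 1 := by
    intro m
    obtain ⟨m', h'⟩ := hs (f m + 1)
    have h1 : m < m' := hf.lt_iff_lt.1 (by omega)
    have h2 : f (m + 1) ≤ f m' := hf.monotone (by omega)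
    have h3 : f m < f (m + 1) := hf (by omega)
    omega
  induction m using Int.induction_on with
  | zero => simp
  | succ i ih => rw [step, ih]; ring
  | pred i ih =>
    have := step (-(i : ℤ) - 1)
    rw [sub_add_cancel, ih] at this
    omega

/-! ### Distances on the circle -/

/-- The blue points are distinct interior points of `[0, L]`. -/
def Generic (L : ℕ) (b : Fin L → ℝ) : Prop := Function.Injective b ∧ ∀ i, b i ∈ Set.Ioo 0 (L : ℝ)

lemma Generic.strictMono_sort {L : ℕ} {b : Fin L → ℝ} (hb : Generic L b) : StrictMono (b ∘ Tuple.sort b) :=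
  (Tuple.monotone_sort b).strictMono_of_injective (hb.1.comp (Tuple.sort b).injective)

section Circle

variable (L : ℕ)

lemma circDist_eq_abs (x y : ℝ) : circDist L x y = |circDisplacement L x y| := by
  rw [circDist, AddCircle.norm_eq, circDisplacement]

lemma circDist_le (x y : ℝ) (k : ℤ) : circDist L x y ≤ |y + k * L - x| := by
  have h : ((y - x : ℝ) : AddCircle (L : ℝ)) = ((y + k * L - x : ℝ) : AddCircle (L : ℝ)) := by
    rw [show y + k * L - x = (y - x) + k • (L : ℝ) by simp; ring]
    simp
  rw [circDist, h, ← Real.norm_eq_abs]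
  exact QuotientAddGroup.norm_mk_le_norm

variable [NeZero L]

/-- The lift of the blue points, in increasing order. -/
def blueLift (b : Fin L → ℝ) : ℤ → ℝ := periodicLift L fun i => b (Tuple.sort b i)

/-- The lift of the blue points, in the order of their red partners. -/
def partnerLift (b : Fin L → ℝ) (π : Equiv.Perm (Fin L)) : ℤ → ℝ :=
  periodicLift L fun j => redPoint L j + circDisplacement L (redPoint L j) (b (π j))

variable {L}
variable {b : Fin L → ℝ}

lemma Generic.eq_of_add_mul_eq (hb : Generic L b) {i j : Fin L} {k l : ℤ}
    (h : b i + k * L = b j + l * L) : i = j ∧ k = l := by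
  have hL := realCast_pos_of_neZero L
  have hi := hb.2 i
  have hj := hb.2 j
  have hkl : k = l := by
    rcases lt_trichotomy k l with h1 | h1 | h1
    · have : (k : ℝ) + 1 ≤ l := by exact_mod_cast h1
      nlinarith [hi.1, hi.2, hj.1, hj.2]
    · exact h1
    · have : (l : ℝ) + 1 ≤ k := by exact_mod_cast h1
      nlinarith [hi.1, hi.2, hj.1, hj.2]
  subst hkl
  exact ⟨hb.1 (by linarith), rfl⟩

lemma Generic.strictMono_blueLift (hb : Generic L b) : StrictMono (blueLift L b) :=
  strictMono_periodicLift_of_bounds hb.strictMono_sort fun _ => hb.2 _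

lemma exists_blueLift_eq (j : Fin L) (k : ℤ) : ∃ n : ℤ, blueLift L b n = b j + k * L := by
  refine ⟨((Tuple.sort b).symm j : ℕ) + k * L, ?_⟩
  rw [blueLift, periodicLift_add_mul, periodicLift_natCast]
  simp

lemma blueLift_eq (m : ℤ) : ∃ k : ℤ, blueLift L b m = b (Tuple.sort b (residue L m)) + k * L :=
  ⟨_, rfl⟩

lemma partnerLift_eq (π : Equiv.Perm (Fin L)) (m : ℤ) :
    ∃ k : ℤ, partnerLift L b π m = b (π (residue L m)) + k * L := by
  refine ⟨-round ((L : ℝ)⁻¹ * (b (π (residue L m)) - redPoint L (residue L m))) + m / (L : ℤ), ?_⟩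
  simp only [partnerLift, periodicLift, circDisplacement]
  push_cast
  ring

lemma exists_partnerLift_eq (π : Equiv.Perm (Fin L)) (j : Fin L) (k : ℤ) :
    ∃ n : ℤ, partnerLift L b π n = b j + k * L := by
  obtain ⟨l, hl⟩ := partnerLift_eq (b := b) π ((π.symm j : ℕ) : ℤ)
  refine ⟨((π.symm j : ℕ) : ℤ) + (k - l) * L, ?_⟩
  have h := periodicLift_add_mul (L := L)
    (fun j => redPoint L j + circDisplacement L (redPoint L j) (b (π j))) ((π.symm j : ℕ) : ℤ) (k - l)
  simp only [residue_natCast, Equiv.apply_symm_apply] at hl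
  unfold partnerLift at hl ⊢
  rw [h, hl]
  push_cast
  ring

lemma circDist_redPoint_eq (π : Equiv.Perm (Fin L)) (m : ℤ) :
    circDist L (redPoint L (residue L m)) (b (π (residue L m))) ^ 2
      = (partnerLift L b π m - (m + 1 / 2)) ^ 2 := by
  rw [circDist_eq_abs, sq_abs, ← periodicLift_redPoint (L := L) m]
  simp only [partnerLift, periodicLift]
  ring

/-- Partners of an optimal matching appear in increasing order: otherwise exchange two of them. -/
lemma strictMono_partnerLift (hb : Generic L b) {π : Equiv.Perm (Fin L)}
    (hπ : IsOptimalMatching L b π) : StrictMono (partnerLift L b π) := by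
  intro m m' hmm
  by_contra hle
  rw [not_lt] at hle
  have hL := realCast_pos_of_neZero L
  by_cases hij : residue L m = residue L m'
  -- Two copies of the same red point: the lift increases by a positive multiple of `L`, so no
  -- crossing is possible.
  · have h1 := eq_residue_add (L := L) m
    have h2 := eq_residue_add (L := L) m'
    have h3 : m' = m + (m' / (L : ℤ) - m / (L : ℤ)) * L := by
      rw [hij] at h1; linarith
    have h4 : 0 < m' / (L : ℤ) - m / (L : ℤ) := by
      have := cast_pos_of_neZero L
      by_contra hneg
      nlinarith
    have h5 : partnerLift L b π m' =
        partnerLift L b π m + ((m' / (L : ℤ) - m / (L : ℤ) : ℤ) : ℝ) * L := by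
      conv_lhs => rw [h3]
      exact periodicLift_add_mul _ _ _
    have h6 : (1 : ℝ) ≤ ((m' / (L : ℤ) - m / (L : ℤ) : ℤ) : ℝ) := by exact_mod_cast h4
    nlinarith
  · obtain ⟨k, hk⟩ := partnerLift_eq (b := b) π m
    obtain ⟨k', hk'⟩ := partnerLift_eq (b := b) π m'
    set i := residue L m with hi
    set j := residue L m' with hj
    have hne : partnerLift L b π m ≠ partnerLift L b π m' := by
      intro h
      rw [hk, hk'] at h
      exact hij (π.injective (hb.eq_of_add_mul_eq h).1)
    have hlt : partnerLift L b π m' < partnerLift L b π m := lt_of_le_of_ne hle hne.symm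
    -- For the exchanged pair the lifted positions give only upper bounds on the circular distances,
    -- which suffices. Exchanging lowers the sum of squares by `2 (m' - m) (P m - P m') > 0`, where
    -- `P` is the lift of the partners.
    have hopt := hπ ((Equiv.swap i j).trans π)
    have hmi := eq_residue_add (L := L) m
    have hmj := eq_residue_add (L := L) m'
    have e1 : circDist L (redPoint L i) (b (π j)) ^ 2 ≤ (partnerLift L b π m' - (m + 1 / 2)) ^ 2 := by
      have := circDist_le L (redPoint L i) (b (π j)) (k' - m / (L : ℤ))
      rw [← sq_abs (partnerLift L b π m' - (m + 1 / 2))]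
      refine pow_le_pow_left₀ (norm_nonneg _) (this.trans_eq ?_) 2
      rw [hk', ← periodicLift_redPoint (L := L) m]
      simp only [periodicLift, ← hi]
      push_cast
      congr 1
      ring
    have e2 : circDist L (redPoint L j) (b (π i)) ^ 2 ≤ (partnerLift L b π m - (m' + 1 / 2)) ^ 2 := by
      have := circDist_le L (redPoint L j) (b (π i)) (k - m' / (L : ℤ))
      rw [← sq_abs (partnerLift L b π m - (m' + 1 / 2))]
      refine pow_le_pow_left₀ (norm_nonneg _) (this.trans_eq ?_) 2
      rw [hk, ← periodicLift_redPoint (L := L) m']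
      simp only [periodicLift, ← hj]
      push_cast
      congr 1
      ring
    have e3 := circDist_redPoint_eq (b := b) π m
    have e4 := circDist_redPoint_eq (b := b) π m'
    rw [← hi] at e3
    rw [← hj] at e4
    unfold matchingCost at hopt
    rw [← Finset.add_sum_erase _ _ (Finset.mem_univ i),
      ← Finset.add_sum_erase (Finset.univ.erase i) _
        (Finset.mem_erase.2 ⟨fun h => hij h.symm, Finset.mem_univ j⟩),
      ← Finset.add_sum_erase Finset.univ (fun x => circDist L (redPoint L x)
        (b (((Equiv.swap i j).trans π) x)) ^ 2) (Finset.mem_univ i),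
      ← Finset.add_sum_erase (Finset.univ.erase i) (fun x => circDist L (redPoint L x)
        (b (((Equiv.swap i j).trans π) x)) ^ 2)
        (Finset.mem_erase.2 ⟨fun h => hij h.symm, Finset.mem_univ j⟩)] at hopt
    have e5 : ∑ x ∈ (Finset.univ.erase i).erase j, circDist L (redPoint L x)
        (b (((Equiv.swap i j).trans π) x)) ^ 2 =
        ∑ x ∈ (Finset.univ.erase i).erase j, circDist L (redPoint L x) (b (π x)) ^ 2 := by
      refine Finset.sum_congr rfl fun x hx => ?_
      simp only [Finset.mem_erase] at hx
      rw [Equiv.trans_apply, Equiv.swap_apply_of_ne_of_ne hx.2.1 hx.1]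
    rw [e5] at hopt
    simp only [Equiv.trans_apply, Equiv.swap_apply_left, Equiv.swap_apply_right] at hopt
    have hmm' : (m : ℝ) < m' := by exact_mod_cast hmm
    nlinarith [mul_pos (sub_pos.2 hmm') (sub_pos.2 hlt)]

/-- Both lifts are strictly increasing enumerations of the same set, the blue points translated by
`L ℤ`, so the change of index is an increasing bijection of `ℤ`, that is, a translation. -/
lemma exists_partnerLift_eq_blueLift (hb : Generic L b) {π : Equiv.Perm (Fin L)}
    (hπ : IsOptimalMatching L b π) :
    ∃ q : ℤ, ∀ m, partnerLift L b π m = blueLift L b (m + q) := by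
  have h : ∀ m, ∃ n, blueLift L b n = partnerLift L b π m := by
    intro m
    obtain ⟨k, hk⟩ := partnerLift_eq (b := b) π m
    rw [hk]
    exact exists_blueLift_eq _ _
  choose f hf using h
  have hmono : StrictMono f := by
    intro m m' hm
    rw [← hb.strictMono_blueLift.lt_iff_lt, hf, hf]
    exact strictMono_partnerLift hb hπ hm
  have hsurj : Function.Surjective f := by
    intro n
    obtain ⟨k, hk⟩ := blueLift_eq (b := b) n
    obtain ⟨m, hm⟩ := exists_partnerLift_eq (b := b) π (Tuple.sort b (residue L n)) k
    refine ⟨m, hb.strictMono_blueLift.injective ?_⟩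
    rw [hf, hm, hk]
  exact ⟨f 0, fun m => by rw [← StrictMono.int_eq_add hmono hsurj, hf]⟩

end Circle

/-! ### The optimal matching is a cyclic shift -/

section OptimalShift

variable {L : ℕ} [NeZero L] {b : Fin L → ℝ}

lemma isOptimalMatching_optimalMatching (L : ℕ) (b : Fin L → ℝ) :
    IsOptimalMatching L b (optimalMatching L b) :=
  (Finite.exists_min (matchingCost L b)).choose_spec

/-- In the lifted indices, the optimal matching is a shift by an integer. -/
lemma exists_shift (hb : Generic L b) : ∃ q : ℤ, ∀ j : Fin L,
    redPoint L j + displacement L b j = blueLift L b (j + q) := by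
  obtain ⟨q, hq⟩ := exists_partnerLift_eq_blueLift hb (isOptimalMatching_optimalMatching L b)
  refine ⟨q, fun j => ?_⟩
  rw [← hq, partnerLift, periodicLift_natCast, displacement]

/-- The integer shift of the optimal matching on the lifted indices. -/
def liftShift (L : ℕ) [NeZero L] (b : Fin L → ℝ) : ℤ :=
  open Classical in if hb : Generic L b then (exists_shift hb).choose else 0

lemma redPoint_add_displacement (hb : Generic L b) (j : Fin L) :
    redPoint L j + displacement L b j = blueLift L b (j + liftShift L b) := by
  rw [liftShift, dif_pos hb]
  exact (exists_shift hb).choose_spec j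

lemma optimalMatching_apply (hb : Generic L b) (j : Fin L) :
    optimalMatching L b j = Tuple.sort b (residue L (j + liftShift L b)) := by
  have h := redPoint_add_displacement hb j
  obtain ⟨k, hk⟩ := blueLift_eq (b := b) ((j : ℕ) + liftShift L b)
  rw [hk, displacement, circDisplacement] at h
  refine (hb.eq_of_add_mul_eq (k := -round ((L : ℝ)⁻¹ * (b (optimalMatching L b j) -
    redPoint L j))) (l := k) ?_).1
  push_cast
  linarith

/-- The matching, viewed as a permutation, remembers the shift only modulo `L`; the lifted shift is
a specific integer, and the two may differ until a size bound is available. -/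
lemma optimalShift_eq (hb : Generic L b) : optimalShift L b = Int.bmod (liftShift L b) L := by
  rw [optimalShift, dif_pos (NeZero.pos L), optimalMatching_apply hb, Equiv.symm_apply_apply,
    residue_val]
  simp

lemma optimalMatching_eq_sort (hb : Generic L b) {i j : Fin L}
    (h : (j : ℤ) ≡ (i : ℤ) - optimalShift L b [ZMOD (L : ℤ)]) :
    optimalMatching L b j = Tuple.sort b i := by
  rw [optimalMatching_apply hb]
  congr 1
  conv_rhs => rw [← residue_natCast L i]
  rw [residue_eq_iff]
  have h1 : optimalShift L b ≡ liftShift L b [ZMOD (L : ℤ)] := by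
    rw [optimalShift_eq hb]
    exact Int.bmod_emod
  have h2 := h.add h1.symm
  rw [sub_add_cancel] at h2
  exact h2

lemma periodic_blueLift_sub (m k : ℤ) :
    blueLift L b (m + k * L) - (m + k * L : ℤ) = blueLift L b m - m := by
  rw [blueLift, periodicLift_add_mul]
  push_cast
  ring

lemma blueLift_sub_eq (m : ℤ) : blueLift L b m - m = orderedDisplacement L b (residue L m) + 1 / 2 := by
  have h := periodic_blueLift_sub (b := b) ((residue L m : ℕ) : ℤ) (m / (L : ℤ))
  rw [← eq_residue_add (L := L) m] at h
  rw [h, blueLift, periodicLift_natCast, orderedDisplacement, redPoint]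
  push_cast
  ring

/-- The difference between the lifted blue point and its index is `L`-periodic, so shifting the
index by `q` permutes the ordered displacements cyclically and adds `q` to each of them. -/
lemma displacement_eq (hb : Generic L b) (j : Fin L) :
    displacement L b j = orderedDisplacement L b (residue L (j + liftShift L b)) + liftShift L b := by
  have h1 := redPoint_add_displacement hb j
  have h2 := blueLift_sub_eq (b := b) (j + liftShift L b)
  rw [redPoint] at h1
  push_cast at h1 h2
  linarith

lemma sum_residue_add (f : Fin L → ℝ) (q : ℤ) :
    ∑ j : Fin L, f (residue L (j + q)) = ∑ j, f j :=
  Equiv.sum_comp (cyclicShift L q) f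

lemma matchingCost_optimal (hb : Generic L b) : matchingCost L b (optimalMatching L b) =
    ∑ i, (orderedDisplacement L b i + liftShift L b) ^ 2 := by
  rw [← sum_residue_add _ (liftShift L b), matchingCost]
  refine Finset.sum_congr rfl fun j _ => ?_
  rw [circDist_eq_abs, sq_abs, ← displacement, displacement_eq hb]

/-- The lifted displacement is one representative modulo `L` and need not be the shortest, hence an
inequality; for the optimal matching the analogous relation is an equality. -/
lemma matchingCost_cyclicShift_le (q : ℤ) :
    matchingCost L b ((cyclicShift L q).trans (Tuple.sort b)) ≤
      ∑ i, (orderedDisplacement L b i + q) ^ 2 := by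
  rw [← sum_residue_add _ q, matchingCost]
  refine Finset.sum_le_sum fun j _ => ?_
  rw [Equiv.trans_apply, cyclicShift_apply]
  have h := circDist_le L (redPoint L j) (b (Tuple.sort b (residue L (j + q))))
    (((j : ℤ) + q) / (L : ℤ))
  rw [← sq_abs (orderedDisplacement L b _ + q)]
  refine pow_le_pow_left₀ (norm_nonneg _) (h.trans_eq ?_) 2
  have h2 := blueLift_sub_eq (b := b) (j + q)
  rw [blueLift, periodicLift] at h2
  congr 1
  rw [redPoint]
  push_cast at h2 ⊢
  linarith

/-- The mean displacement of the blue points from the red points. -/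
lemma sum_orderedDisplacement (b : Fin L → ℝ) :
    ∑ i, orderedDisplacement L b i = ∑ j, (b j - L / 2) := by
  simp only [orderedDisplacement, redPoint, Finset.sum_sub_distrib]
  rw [Equiv.sum_comp (Tuple.sort b) b]
  congr 1
  rw [Finset.sum_add_distrib, Fin.sum_univ_eq_sum_range (fun i => (i : ℝ)) L]
  have := Finset.sum_range_id_mul_two L
  have h2 : (∑ i ∈ Finset.range L, (i : ℝ)) * 2 = L * (L - 1) := by
    have h3 := congrArg (fun n : ℕ => (n : ℝ)) this
    push_cast [Nat.cast_sub (NeZero.pos L)] at h3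
    exact h3
  simp
  linarith

/-- The optimal shift is the integer that is closest to minus the mean displacement. -/
lemma abs_liftShift_add_le (hb : Generic L b) :
    |(liftShift L b : ℝ) + (∑ j, (b j - L / 2)) / L| ≤ 1 / 2 := by
  have hL := realCast_pos_of_neZero L
  have key : ∀ q : ℤ, ∑ i, (orderedDisplacement L b i + liftShift L b) ^ 2 ≤
      ∑ i, (orderedDisplacement L b i + q) ^ 2 := fun q => by
    rw [← matchingCost_optimal hb]
    exact (isOptimalMatching_optimalMatching L b _).trans (matchingCost_cyclicShift_le q)
  rw [← sum_orderedDisplacement]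
  set S := ∑ i, orderedDisplacement L b i
  have expand : ∀ q : ℝ, ∑ i, (orderedDisplacement L b i + q) ^ 2 =
      ∑ i, orderedDisplacement L b i ^ 2 + 2 * q * S + L * q ^ 2 := by
    intro q
    simp only [add_sq, Finset.sum_add_distrib, S, Finset.mul_sum]
    simp
    exact Finset.sum_congr rfl fun i _ => by ring
  -- The cost is a parabola in the shift, so comparison with the two neighbouring integers already
  -- locates the vertex to within `1/2`.
  have k1 := key (liftShift L b + 1)
  have k2 := key (liftShift L b - 1)
  rw [expand, expand] at k1 k2
  push_cast at k1 k2
  have hS : S = S / L * L := by field_simp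
  set M := S / L
  rw [hS] at k1 k2
  rw [abs_le]
  constructor
  · have : 0 ≤ L * (2 * (liftShift L b + M) + 1) := by linarith
    have := nonneg_of_mul_nonneg_right this hL
    linarith
  · have : 0 ≤ L * (1 - 2 * (liftShift L b + M)) := by linarith
    have := nonneg_of_mul_nonneg_right this hL
    linarith

end OptimalShift


/-! ### Almost sure properties of the blue points -/

section Null

/-- Fubini, integrating out the `i`-th coordinate first: every slice of the zero set is countable,
hence null for a measure without atoms. -/
lemma ae_pi_ne_zero_of_countable {ι : Type*} [Fintype ι] [DecidableEq ι] (μ : ι → Measure ℝ)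
    [∀ i, SigmaFinite (μ i)] (i : ι) [NullSingletonClass (μ i)] {f : (ι → ℝ) → ℝ} (hf : Measurable f)
    (h : ∀ b, {x | f (Function.update b i x) = 0}.Countable) :
    ∀ᵐ b ∂(Measure.pi μ), f b ≠ 0 := by
  have hS : MeasurableSet {b | f b = 0} := measurableSet_eq_fun hf measurable_const
  rw [ae_iff]
  simp only [not_not]
  rw [← lintegral_indicator_one hS]
  have hm : Measurable ({b | f b = 0}.indicator (1 : (ι → ℝ) → ENNReal)) :=
    measurable_one.indicator hS
  rw [lintegral_eq_lmarginal_univ (fun _ => 0), lmarginal_erase' _ hm (Finset.mem_univ i)]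
  have : (fun x => ∫⁻ xᵢ, {b | f b = 0}.indicator (1 : (ι → ℝ) → ENNReal)
      (Function.update x i xᵢ) ∂μ i) = 0 := by
    ext x
    have e : (fun xᵢ => {b | f b = 0}.indicator (1 : (ι → ℝ) → ENNReal) (Function.update x i xᵢ)) =
        {t | f (Function.update x i t) = 0}.indicator 1 := by
      ext t
      simp [Set.indicator]
    rw [e, lintegral_indicator_one]
    · exact (h x).measure_zero (μ i)
    · exact hS.preimage (measurable_update x)
  rw [this]
  simp [lmarginal]

lemma measurable_circDisplacement (L : ℕ) (x : ℝ) : Measurable (circDisplacement L x) := by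
  unfold circDisplacement
  simp only [round_eq]
  have : Measurable fun y : ℝ => ((⌊(L : ℝ)⁻¹ * (y - x) + 1 / 2⌋ : ℤ) : ℝ) :=
    (measurable_of_countable (fun n : ℤ => (n : ℝ))).comp
      (Int.measurable_floor.comp (by fun_prop))
  fun_prop

lemma measurable_matchingCost (L : ℕ) (π : Equiv.Perm (Fin L)) :
    Measurable fun b => matchingCost L b π := by
  unfold matchingCost
  simp only [circDist_eq_abs, sq_abs]
  refine Finset.measurable_sum _ fun i _ => ?_
  exact ((measurable_circDisplacement L _).comp (measurable_pi_apply _)).pow_const 2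

/-- Once the two rounding integers are fixed, the quadratic terms cancel and the equation is affine
in `x`. Its slope is nonzero because distinct red points are distinct modulo `L`. -/
lemma countable_sq_circDist_sub (L : ℕ) [NeZero L] {i j : Fin L} (hij : i ≠ j) (y : ℝ) :
    {x | circDist L (redPoint L i) x ^ 2 - circDist L (redPoint L j) x ^ 2 = y}.Countable := by
  have hsub : {x | circDist L (redPoint L i) x ^ 2 - circDist L (redPoint L j) x ^ 2 = y} ⊆
      ⋃ k : ℤ, ⋃ l : ℤ, {x | (x - redPoint L i - k * L) ^ 2 - (x - redPoint L j - l * L) ^ 2 = y} := by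
    intro x hx
    simp only [Set.mem_ofPred_eq, circDist_eq_abs, sq_abs, circDisplacement] at hx
    simp only [Set.mem_iUnion]
    exact ⟨_, _, hx⟩
  refine Set.Countable.mono hsub ?_
  refine Set.countable_iUnion fun k => Set.countable_iUnion fun l => Set.Subsingleton.countable ?_
  intro x hx x' hx'
  simp only [Set.mem_ofPred_eq] at hx hx'
  have hne : redPoint L i + k * L - (redPoint L j + l * L) ≠ 0 := by
    intro h
    have hz : ((i : ℕ) : ℤ) + k * L = ((j : ℕ) : ℤ) + l * L := by
      have : ((i : ℕ) : ℝ) + k * L = ((j : ℕ) : ℝ) + l * L := by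
        simp only [redPoint] at h; linarith
      exact_mod_cast this
    have := congrArg (residue L) hz
    rw [residue_add_mul, residue_add_mul, residue_natCast, residue_natCast] at this
    exact hij this
  have hprod : (redPoint L i + k * L - (redPoint L j + l * L)) * (x - x') = 0 := by linarith
  rcases mul_eq_zero.1 hprod with h | h
  · exact absurd h hne
  · linarith

end Null

/-! ### Almost sure uniqueness of the optimal matching, and measurability of the observables -/

section BlueLaw

lemma existsUnique_isOptimalMatching {L : ℕ} {b : Fin L → ℝ}
    (hb : Function.Injective (matchingCost L b)) :
    ∃! π : Equiv.Perm (Fin L), IsOptimalMatching L b π :=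
  ⟨optimalMatching L b, isOptimalMatching_optimalMatching L b, fun _ hπ =>
    hb (le_antisymm (hπ _) (isOptimalMatching_optimalMatching L b _))⟩

variable (L : ℕ) [NeZero L]

instance isProbabilityMeasure_cond_Icc :
    IsProbabilityMeasure ((volume : Measure ℝ)[|Set.Icc 0 (L : ℝ)]) := by
  have hL : L ≠ 0 := NeZero.ne L
  refine cond_isProbabilityMeasure_of_finite ?_ ?_ <;> simp [hL]

instance nullSingletonClass_cond_Icc : NullSingletonClass ((volume : Measure ℝ)[|Set.Icc 0 (L : ℝ)]) := by
  refine ⟨fun x => ?_⟩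
  exact (cond_absolutelyContinuous (μ := (volume : Measure ℝ))) (by simp)

lemma ae_generic : ∀ᵐ b ∂(blueLaw L), Generic L b := by
  classical
  have h1 : ∀ᵐ b ∂(blueLaw L), ∀ i j : Fin L, i ≠ j → b i - b j ≠ 0 := by
    refine ae_all_iff.2 fun i => ae_all_iff.2 fun j => ?_
    by_cases hij : i = j
    · simp [hij]
    · filter_upwards [ae_pi_ne_zero_of_countable _ i (f := fun b => b i - b j) (by fun_prop)
        (fun b => by
          have : {x | Function.update b i x i - Function.update b i x j = 0} = {b j} := by
            ext x
            simp [Function.update_of_ne (Ne.symm hij), sub_eq_zero]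
          rw [this]; exact Set.countable_singleton (b j))] with b hb _ using hb
  have h2 : ∀ c : ℝ, ∀ᵐ b ∂(blueLaw L), ∀ i : Fin L, b i - c ≠ 0 := by
    refine fun c => ae_all_iff.2 fun i => ?_
    refine ae_pi_ne_zero_of_countable _ i (f := fun b => b i - c) (by fun_prop) fun b => ?_
    have : {x | Function.update b i x i - c = 0} = {c} := by
      ext x
      simp [sub_eq_zero]
    rw [this]; exact Set.countable_singleton c
  have h3 : ∀ᵐ b ∂(blueLaw L), ∀ i : Fin L, b i ∈ Set.Icc 0 (L : ℝ) := by
    refine ae_all_iff.2 fun i => ?_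
    exact (measurePreserving_eval (fun _ : Fin L => (volume : Measure ℝ)[|Set.Icc 0 (L : ℝ)])
      i).quasiMeasurePreserving.ae (p := fun x => x ∈ Set.Icc 0 (L : ℝ))
      (ae_cond_mem measurableSet_Icc)
  filter_upwards [h1, h2 0, h2 L, h3] with b hb1 hb2 hb3 hb4
  refine ⟨fun i j hij => ?_, fun i => ⟨?_, ?_⟩⟩
  · by_contra hne
    exact hb1 i j hne (sub_eq_zero.2 hij)
  · exact lt_of_le_of_ne (hb4 i).1 fun h => hb2 i (by linarith)
  · exact lt_of_le_of_ne (hb4 i).2 fun h => hb3 i (by linarith)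

lemma ae_injective_matchingCost : ∀ᵐ b ∂(blueLaw L), Function.Injective (matchingCost L b) := by
  classical
  have h : ∀ᵐ b ∂(blueLaw L), ∀ π π' : Equiv.Perm (Fin L), π ≠ π' →
      matchingCost L b π - matchingCost L b π' ≠ 0 := by
    refine ae_all_iff.2 fun π => ae_all_iff.2 fun π' => ?_
    by_cases hπ : π = π'
    · simp [hπ]
    -- Only the blue point `j`, with different red partners in the two matchings, is varied; all
    -- other cost terms are constant in it.
    obtain ⟨j, hj⟩ : ∃ j, π.symm j ≠ π'.symm j := by
      by_contra hall
      push Not at hall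
      exact hπ (by simpa using congrArg Equiv.symm (Equiv.ext hall : π.symm = π'.symm))
    filter_upwards [ae_pi_ne_zero_of_countable _ j
      (f := fun b => matchingCost L b π - matchingCost L b π')
      ((measurable_matchingCost L π).sub (measurable_matchingCost L π')) (fun b => by
        have key : ∀ σ : Equiv.Perm (Fin L), ∃ c : ℝ, ∀ x,
            matchingCost L (Function.update b j x) σ =
              circDist L (redPoint L (σ.symm j)) x ^ 2 + c := by
          intro σ
          refine ⟨∑ i ∈ Finset.univ.erase (σ.symm j), circDist L (redPoint L i) (b (σ i)) ^ 2,
            fun x => ?_⟩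
          rw [matchingCost, ← Finset.add_sum_erase _ _ (Finset.mem_univ (σ.symm j))]
          congr 1
          · simp
          · refine Finset.sum_congr rfl fun i hi => ?_
            rw [Function.update_of_ne]
            intro h
            rw [Finset.mem_erase] at hi
            exact hi.1 (by rw [← h, Equiv.symm_apply_apply])
        obtain ⟨c, hc⟩ := key π
        obtain ⟨c', hc'⟩ := key π'
        refine (countable_sq_circDist_sub L hj (c' - c)).mono fun x hx => ?_
        simp only [Set.mem_ofPred_eq] at hx ⊢
        have e : matchingCost L (Function.update b j x) π -
          matchingCost L (Function.update b j x) π' = 0 := hx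
        rw [hc, hc'] at e
        linarith)] with b hb _ using hb
  filter_upwards [h] with b hb π π' heq
  by_contra hne
  exact hb π π' hne (sub_eq_zero.2 heq)

theorem ae_optimalMatching_cyclic (L : ℕ) : ∀ᵐ b ∂(blueLaw L),
    (∃! π : Equiv.Perm (Fin L), IsOptimalMatching L b π) ∧
      ∀ i j : Fin L, (j : ℤ) ≡ (i : ℤ) - optimalShift L b [ZMOD (L : ℤ)] →
        optimalMatching L b j = Tuple.sort b i := by
  rcases Nat.eq_zero_or_pos L with rfl | hL
  · exact ae_of_all _ fun b => ⟨⟨1, fun _ => by simp [matchingCost], fun _ _ =>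
      Subsingleton.elim _ _⟩, fun i => i.elim0⟩
  · have : NeZero L := ⟨hL.ne'⟩
    filter_upwards [ae_generic L, ae_injective_matchingCost L] with b hb hb'
    exact ⟨existsUnique_isOptimalMatching hb', fun i j h => optimalMatching_eq_sort hb h⟩

/-- Quantities that are measurable for each given order of the blue points and each given optimal
matching are almost everywhere measurable. -/
lemma aemeasurable_of_sort_of_optimalMatching
    {F : Equiv.Perm (Fin L) → Equiv.Perm (Fin L) → (Fin L → ℝ) → ℝ}
    (hF : ∀ σ π, Measurable (F σ π)) :
    AEMeasurable (fun b => F (Tuple.sort b) (optimalMatching L b) b) (blueLaw L) := by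
  classical
  let A : Equiv.Perm (Fin L) → Equiv.Perm (Fin L) → Set (Fin L → ℝ) := fun σ π =>
    (⋂ i : Fin L, ⋂ j : Fin L, {b | i ≤ j → b (σ i) ≤ b (σ j)}) ∩
      ⋂ π', {b | matchingCost L b π ≤ matchingCost L b π'}
  have hA : ∀ σ π, MeasurableSet (A σ π) := by
    intro σ π
    refine MeasurableSet.inter (MeasurableSet.iInter fun i => MeasurableSet.iInter fun j => ?_)
      (MeasurableSet.iInter fun π' =>
        measurableSet_le (measurable_matchingCost L π) (measurable_matchingCost L π'))
    by_cases hij : i ≤ j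
    · simpa [hij] using measurableSet_le (measurable_pi_apply (σ i)) (measurable_pi_apply (σ j))
    · simp [hij]
  refine ⟨fun b => ∑ σ, ∑ π, (A σ π).indicator (F σ π) b, ?_, ?_⟩
  · exact Finset.measurable_sum _ fun σ _ => Finset.measurable_sum _ fun π _ =>
      (hF σ π).indicator (hA σ π)
  · filter_upwards [ae_generic L, ae_injective_matchingCost L] with b hb hb'
    -- Almost surely exactly one cell of this finite family contains `b`, because the sorting
    -- permutation and the optimal matching are unique.
    have hmem : ∀ σ π, b ∈ A σ π ↔ σ = Tuple.sort b ∧ π = optimalMatching L b := by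
      intro σ π
      have e1 : b ∈ (⋂ i : Fin L, ⋂ j : Fin L, {b : Fin L → ℝ | i ≤ j → b (σ i) ≤ b (σ j)}) ↔
          Monotone (b ∘ σ) := by
        simp [Monotone]
      rw [Set.mem_inter_iff, e1]
      refine and_congr ?_ ?_
      · rw [← Tuple.comp_sort_eq_comp_iff_monotone]
        exact ⟨fun h => Equiv.ext fun i => hb.1 (congrFun h i), fun h => by rw [h]⟩
      · simp only [Set.mem_iInter, Set.mem_ofPred_eq]
        refine ⟨fun h => hb' (le_antisymm (h _) (isOptimalMatching_optimalMatching L b _)), ?_⟩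
        rintro rfl
        exact isOptimalMatching_optimalMatching L b
    rw [Finset.sum_eq_single (Tuple.sort b), Finset.sum_eq_single (optimalMatching L b)]
    · rw [Set.indicator_of_mem ((hmem _ _).2 ⟨rfl, rfl⟩)]
    · intro π _ hπ
      exact Set.indicator_of_notMem (fun h => hπ ((hmem _ _).1 h).2) _
    · simp
    · intro σ _ hσ
      exact Finset.sum_eq_zero fun π _ =>
        Set.indicator_of_notMem (fun h => hσ ((hmem _ _).1 h).1) _
    · simp

lemma aemeasurable_displacement (L : ℕ) (i : Fin L) :
    AEMeasurable (fun b => displacement L b i) (blueLaw L) := by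
  have : NeZero L := ⟨i.pos.ne'⟩
  exact aemeasurable_of_sort_of_optimalMatching L
    (F := fun _ π b => circDisplacement L (redPoint L i) (b (π i)))
    fun _ π => (measurable_circDisplacement L _).comp (measurable_pi_apply _)

lemma aemeasurable_orderedDisplacement (L : ℕ) (i : Fin L) :
    AEMeasurable (fun b => orderedDisplacement L b i) (blueLaw L) := by
  have : NeZero L := ⟨i.pos.ne'⟩
  exact aemeasurable_of_sort_of_optimalMatching L
    (F := fun σ _ b => b (σ i) - redPoint L i) fun σ _ => by fun_prop

lemma aemeasurable_scaledShift (L : ℕ) : AEMeasurable (scaledShift L) (blueLaw L) := by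
  rcases Nat.eq_zero_or_pos L with rfl | hL
  · refine (measurable_const (a := (0 : ℝ))).aemeasurable.congr (ae_of_all _ fun b => ?_)
    simp [scaledShift, optimalShift]
  · have : NeZero L := ⟨hL.ne'⟩
    have h := aemeasurable_of_sort_of_optimalMatching L
      (F := fun σ π _ => -((Int.bmod ((σ.symm (π ⟨0, hL⟩) : ℕ) : ℤ) L : ℤ) : ℝ) / √(L : ℝ))
      fun _ _ => measurable_const
    refine h.congr (ae_of_all _ fun b => ?_)
    simp [scaledShift, optimalShift, hL]

lemma aemeasurable_rescale (L : ℕ) {f : (Fin L → ℝ) → Fin L → ℝ}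
    (hf : ∀ i, AEMeasurable (fun b => f b i) (blueLaw L)) (s : unitInterval) :
    AEMeasurable (fun b => rescale L (f b) s) (blueLaw L) := by
  unfold rescale
  split_ifs with h
  · exact (hf _).div_const _
  · exact aemeasurable_const

end BlueLaw


/-! ### Independent uniform points -/

/-- The uniform distribution on the unit interval. -/
def uniformLaw : Measure ℝ := volume.restrict (Set.Ioc 0 1)

instance isProbabilityMeasure_uniformLaw : IsProbabilityMeasure uniformLaw :=
  ⟨by simp [uniformLaw]⟩

/-- The law of a sequence of independent uniform points. -/
def uniformSeq : Measure (ℕ → ℝ) := Measure.infinitePi fun _ => uniformLaw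

instance isProbabilityMeasure_uniformSeq : IsProbabilityMeasure uniformSeq := by
  unfold uniformSeq; infer_instance

/-- The first `L` points, scaled by `L`. -/
def scalePoints (L : ℕ) (u : ℕ → ℝ) (j : Fin L) : ℝ := L * u j

lemma measurable_scalePoints (L : ℕ) : Measurable (scalePoints L) := by
  unfold scalePoints; fun_prop

lemma map_mul_uniformLaw (L : ℕ) [NeZero L] :
    uniformLaw.map (fun x => (L : ℝ) * x) = (volume : Measure ℝ)[|Set.Icc 0 (L : ℝ)] := by
  have hL := realCast_pos_of_neZero L
  ext s hs
  rw [Measure.map_apply (by fun_prop) hs, uniformLaw, Measure.restrict_apply (by measurability),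
    cond_apply measurableSet_Icc]
  have e : (fun x => (L : ℝ) * x) ⁻¹' s ∩ Set.Ioc 0 1 =
      (fun x => (L : ℝ) * x) ⁻¹' (s ∩ Set.Ioc 0 (L : ℝ)) := by
    ext x
    simp only [Set.mem_inter_iff, Set.mem_preimage, Set.mem_Ioc, and_congr_right_iff]
    intro _
    rw [mul_pos_iff_of_pos_left hL]
    refine and_congr_right fun _ => ⟨fun h => by nlinarith, fun h => ?_⟩
    by_contra hlt
    nlinarith
  rw [e, Real.volume_preimage_mul_left hL.ne', abs_of_pos (inv_pos.2 hL), Real.volume_Icc, sub_zero,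
    ENNReal.ofReal_inv_of_pos hL, Set.inter_comm]
  congr 1
  exact measure_congr (Ioc_ae_eq_Icc.inter (ae_eq_refl s))

lemma iIndepFun_uniformSeq {h : ℝ → ℝ} (hh : Measurable h) :
    iIndepFun (fun (j : ℕ) (u : ℕ → ℝ) => h (u j)) uniformSeq :=
  iIndepFun_infinitePi (X := fun _ => h) fun _ => hh

lemma map_eval_uniformSeq (j : ℕ) : uniformSeq.map (fun u => u j) = uniformLaw :=
  Measure.infinitePi_map_eval _ j

lemma map_comp_eval_uniformSeq {h : ℝ → ℝ} (hh : Measurable h) (j : ℕ) :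
    uniformSeq.map (fun u => h (u j)) = uniformLaw.map h := by
  rw [← map_eval_uniformSeq j, Measure.map_map hh (measurable_pi_apply j)]
  rfl

lemma map_scalePoints_uniformSeq (L : ℕ) : uniformSeq.map (scalePoints L) = blueLaw L := by
  have h := (iIndepFun_uniformSeq (h := fun x => (L : ℝ) * x) (by fun_prop)).precomp
    (Fin.val_injective (n := L))
  rw [iIndepFun_iff_map_fun_eq_pi_map (fun i => (Measurable.const_mul (measurable_pi_apply _) _).aemeasurable)] at h
  rw [blueLaw]
  refine h.trans ?_
  congr 1
  ext1 i
  have : NeZero L := ⟨i.pos.ne'⟩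
  rw [map_comp_eval_uniformSeq (h := fun x => (L : ℝ) * x) (by fun_prop), map_mul_uniformLaw]

lemma integral_uniformSeq_eval {h : ℝ → ℝ} (hh : Measurable h) (j : ℕ) :
    ∫ u, h (u j) ∂uniformSeq = ∫ x, h x ∂uniformLaw := by
  rw [← map_eval_uniformSeq j, integral_map (measurable_pi_apply j).aemeasurable
    hh.aestronglyMeasurable]

lemma integral_uniformLaw (h : ℝ → ℝ) : ∫ x, h x ∂uniformLaw = ∫ x in (0 : ℝ)..1, h x := by
  rw [intervalIntegral.integral_of_le zero_le_one, uniformLaw]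

lemma memLp_uniformLaw {h : ℝ → ℝ} (hh : Measurable h) {C : ℝ} (hC : ∀ x, |h x| ≤ C) :
    MemLp h 2 uniformLaw :=
  MemLp.of_bound hh.aestronglyMeasurable C (ae_of_all _ hC)

lemma memLp_uniformSeq_eval {h : ℝ → ℝ} (hL : MemLp h 2 uniformLaw) (j : ℕ) :
    MemLp (fun u => h (u j)) 2 uniformSeq := by
  rw [← map_eval_uniformSeq j] at hL
  exact hL.comp_of_map (measurable_pi_apply j).aemeasurable

/-- Chebyshev's inequality for sums of centred functions of the points. -/
lemma measureReal_le_abs_sum {h : ℝ → ℝ} (hh : Measurable h) (hL : MemLp h 2 uniformLaw)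
    (h0 : ∫ x, h x ∂uniformLaw = 0) (n : ℕ) {a v : ℝ} (ha : 0 < a)
    (hv : ∫ x, h x ^ 2 ∂uniformLaw ≤ v) :
    uniformSeq.real {u | a ≤ |∑ j ∈ Finset.range n, h (u j)|} ≤ n * v / a ^ 2 := by
  have hm : ∀ j : ℕ, MemLp (fun u : ℕ → ℝ => h (u j)) 2 uniformSeq := memLp_uniformSeq_eval hL
  have hvar : Var[∑ j ∈ Finset.range n, (fun u : ℕ → ℝ => h (u j)); uniformSeq] =
      n * ∫ x, h x ^ 2 ∂uniformLaw := by
    rw [IndepFun.variance_sum (fun j _ => hm j)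
      (fun i _ j _ hij => (iIndepFun_uniformSeq hh).indepFun hij)]
    have : ∀ j ∈ Finset.range n, Var[fun u : ℕ → ℝ => h (u j); uniformSeq] =
        ∫ x, h x ^ 2 ∂uniformLaw := by
      intro j _
      rw [variance_of_integral_eq_zero (hm j).aemeasurable
        (by rw [integral_uniformSeq_eval hh, h0])]
      exact integral_uniformSeq_eval (hh.pow_const 2) j
    rw [Finset.sum_congr rfl this]
    simp
  have hmean : uniformSeq[∑ j ∈ Finset.range n, (fun u : ℕ → ℝ => h (u j))] = 0 := by
    simp only [Finset.sum_apply]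
    rw [integral_finsetSum _ fun j _ => (hm j).integrable one_le_two]
    exact Finset.sum_eq_zero fun j _ => by rw [integral_uniformSeq_eval hh, h0]
  have key := meas_ge_le_variance_div_sq (memLp_finsetSum' (Finset.range n) fun j _ => hm j) ha
  rw [hmean, hvar] at key
  simp only [Finset.sum_apply, sub_zero] at key
  rw [measureReal_def]
  refine (ENNReal.toReal_mono ENNReal.ofReal_ne_top key).trans ?_
  have h2 : 0 ≤ ∫ x, h x ^ 2 ∂uniformLaw := integral_nonneg fun x => sq_nonneg _
  rw [ENNReal.toReal_ofReal (by positivity)]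
  gcongr

/-! ### The sawtooth function -/

lemma integral_uniformLaw_periodic {F : ℝ → ℝ} (hF : Function.Periodic F 1) (s : ℝ) :
    ∫ u, F (s - u) ∂uniformLaw = ∫ x in (0 : ℝ)..1, F x := by
  rw [integral_uniformLaw, intervalIntegral.integral_comp_sub_left F s]
  have := hF.intervalIntegral_add_eq (s - 1) 0
  simpa using this

lemma intervalIntegral_comp_fract (g : ℝ → ℝ) :
    ∫ x in (0 : ℝ)..1, g (Int.fract x) = ∫ x in (0 : ℝ)..1, g x := by
  rw [intervalIntegral.integral_of_le zero_le_one, intervalIntegral.integral_of_le zero_le_one,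
    ← integral_Ico_eq_integral_Ioc, ← integral_Ico_eq_integral_Ioc]
  exact setIntegral_congr_fun measurableSet_Ico fun x hx => by rw [Int.fract_eq_self.2 hx]

/-- The centred sawtooth function `u ↦ {s - u} - 1/2`. -/
def sawtooth (s u : ℝ) : ℝ := Int.fract (s - u) - 1 / 2

lemma measurable_sawtooth (s : ℝ) : Measurable (sawtooth s) := by
  unfold sawtooth; fun_prop

lemma abs_sawtooth_le (s u : ℝ) : |sawtooth s u| ≤ 1 / 2 := by
  unfold sawtooth
  rw [abs_le]
  constructor <;> linarith [Int.fract_nonneg (s - u), Int.fract_lt_one (s - u)]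

lemma memLp_sawtooth (s : ℝ) : MemLp (sawtooth s) 2 uniformLaw :=
  memLp_uniformLaw (measurable_sawtooth s) (abs_sawtooth_le s)

lemma integral_sawtooth (s : ℝ) : ∫ u, sawtooth s u ∂uniformLaw = 0 := by
  have := integral_uniformLaw_periodic (F := fun x => Int.fract x - 1 / 2)
    (fun x => by simp) s
  unfold sawtooth
  rw [this, intervalIntegral_comp_fract fun x => x - 1 / 2]
  norm_num [integral_id]

lemma integral_sawtooth_sq (s : ℝ) : ∫ u, sawtooth s u ^ 2 ∂uniformLaw = 1 / 12 := by
  have := integral_uniformLaw_periodic (F := fun x => (Int.fract x - 1 / 2) ^ 2)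
    (fun x => by simp) s
  unfold sawtooth
  rw [this, intervalIntegral_comp_fract fun x => (x - 1 / 2) ^ 2,
    intervalIntegral.integral_comp_sub_right (fun x => x ^ 2) (1 / 2)]
  norm_num [integral_pow]

/-- With `d = t - s`, the increment takes only the values `d` and `d - 1`, the roots of `x^2 = d (1
- d) - (1 - 2 d) x`. The square therefore becomes affine in the increment, whose mean vanishes. -/
lemma sawtooth_sub_sq {s t : ℝ} (h0 : 0 ≤ t - s) (h1 : t - s ≤ 1) (u : ℝ) :
    (sawtooth t u - sawtooth s u) ^ 2 =
      (t - s) * (1 - (t - s)) - (1 - 2 * (t - s)) * (sawtooth t u - sawtooth s u) := by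
  unfold sawtooth
  rw [Int.fract, Int.fract]
  have hk : ⌊t - u⌋ = ⌊s - u⌋ ∨ ⌊t - u⌋ = ⌊s - u⌋ + 1 := by
    have a1 : ⌊s - u⌋ ≤ ⌊t - u⌋ := Int.floor_le_floor (by linarith)
    have a2 : ⌊t - u⌋ ≤ ⌊s - u + 1⌋ := Int.floor_le_floor (by linarith)
    rw [Int.floor_add_one] at a2
    omega
  rcases hk with h | h <;> rw [h] <;> push_cast <;> ring

lemma integral_sawtooth_sub_sq {s t : ℝ} (h1 : |t - s| ≤ 1) :
    ∫ u, (sawtooth t u - sawtooth s u) ^ 2 ∂uniformLaw = |t - s| * (1 - |t - s|) := by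
  wlog h0 : s ≤ t generalizing s t
  · rw [abs_sub_comm] at h1 ⊢
    rw [← this h1 (by linarith)]
    congr 1; ext u; ring
  rw [abs_of_nonneg (by linarith)] at h1 ⊢
  have hi : ∀ s, Integrable (sawtooth s) uniformLaw := fun s =>
    (memLp_sawtooth s).integrable one_le_two
  have hd : Integrable (fun u => sawtooth t u - sawtooth s u) uniformLaw := (hi t).sub (hi s)
  simp_rw [sawtooth_sub_sq (sub_nonneg.2 h0) h1]
  rw [integral_sub (integrable_const _) (hd.const_mul _), integral_const_mul (1 - 2 * (t - s)),
    integral_sub (hi t) (hi s), integral_sawtooth, integral_sawtooth]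
  simp

lemma integral_sawtooth_mul {s t : ℝ} (h1 : |t - s| ≤ 1) :
    ∫ u, sawtooth s u * sawtooth t u ∂uniformLaw = 1 / 12 - |t - s| * (1 - |t - s|) / 2 := by
  have e : ∀ u, sawtooth s u * sawtooth t u = (sawtooth s u ^ 2 + sawtooth t u ^ 2 -
    (sawtooth t u - sawtooth s u) ^ 2) / 2 := fun u => by ring
  simp_rw [e]
  rw [integral_div, integral_sub, integral_add, integral_sawtooth_sub_sq h1, integral_sawtooth_sq,
    integral_sawtooth_sq]
  · ring
  · exact (memLp_sawtooth s).integrable_sq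
  · exact (memLp_sawtooth t).integrable_sq
  · exact (memLp_sawtooth s).integrable_sq.add (memLp_sawtooth t).integrable_sq
  · exact ((memLp_sawtooth t).sub (memLp_sawtooth s)).integrable_sq

/-- The centred identity `u ↦ u - 1/2`. -/
def centredId (u : ℝ) : ℝ := u - 1 / 2

lemma measurable_centredId : Measurable centredId := by unfold centredId; fun_prop

lemma ae_uniformLaw_mem : ∀ᵐ u ∂uniformLaw, u ∈ Set.Ioc (0 : ℝ) 1 :=
  ae_restrict_mem measurableSet_Ioc

lemma memLp_centredId : MemLp centredId 2 uniformLaw := by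
  refine MemLp.of_bound measurable_centredId.aestronglyMeasurable 1 ?_
  filter_upwards [ae_uniformLaw_mem] with u hu
  rw [Real.norm_eq_abs, abs_le, centredId]
  constructor <;> linarith [hu.1, hu.2]

lemma integral_centredId : ∫ u, centredId u ∂uniformLaw = 0 := by
  rw [integral_uniformLaw]
  unfold centredId
  norm_num [integral_id]

lemma integral_centredId_sq : ∫ u, centredId u ^ 2 ∂uniformLaw = 1 / 12 := by
  rw [integral_uniformLaw]
  unfold centredId
  rw [intervalIntegral.integral_comp_sub_right (fun x => x ^ 2) (1 / 2)]
  norm_num [integral_pow]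

/-- The kernel `{s - u} + u - 1` of the Brownian bridge; for `s, u` in the unit interval this is
`s - 1_{u ≤ s}`. -/
def bridgeKernel (s u : ℝ) : ℝ := sawtooth s u + centredId u

lemma measurable_bridgeKernel (s : ℝ) : Measurable (bridgeKernel s) :=
  (measurable_sawtooth s).add measurable_centredId

lemma memLp_bridgeKernel (s : ℝ) : MemLp (bridgeKernel s) 2 uniformLaw :=
  (memLp_sawtooth s).add memLp_centredId

lemma integral_bridgeKernel (s : ℝ) : ∫ u, bridgeKernel s u ∂uniformLaw = 0 := by
  unfold bridgeKernel
  rw [integral_add ((memLp_sawtooth s).integrable one_le_two)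
    (memLp_centredId.integrable one_le_two), integral_sawtooth, integral_centredId, add_zero]

lemma bridgeKernel_eq (s u : ℝ) : bridgeKernel s u = s - ⌊s - u⌋ - 1 := by
  rw [bridgeKernel, sawtooth, centredId, Int.fract]
  ring

lemma abs_bridgeKernel_le {u : ℝ} (hu : u ∈ Set.Ioc (0 : ℝ) 1) (s : ℝ) :
    |bridgeKernel s u| ≤ 1 := by
  rw [bridgeKernel, sawtooth, centredId, abs_le]
  constructor <;> linarith [Int.fract_nonneg (s - u), Int.fract_lt_one (s - u), hu.1, hu.2]

lemma integral_sq_le_one {h : ℝ → ℝ} (hL : MemLp h 2 uniformLaw)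
    (hb : ∀ᵐ u ∂uniformLaw, |h u| ≤ 1) : ∫ u, h u ^ 2 ∂uniformLaw ≤ 1 := by
  have : ∫ u, h u ^ 2 ∂uniformLaw ≤ ∫ _, (1 : ℝ) ∂uniformLaw := by
    refine integral_mono_ae hL.integrable_sq (integrable_const _) ?_
    filter_upwards [hb] with u hu
    exact (sq_le_one_iff_abs_le_one _).2 hu
  simpa using this

lemma integral_bridgeKernel_sub_sq {s t : ℝ} (h1 : |t - s| ≤ 1) :
    ∫ u, (bridgeKernel t u - bridgeKernel s u) ^ 2 ∂uniformLaw = |t - s| * (1 - |t - s|) := by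
  rw [← integral_sawtooth_sub_sq h1]
  congr 1; ext u
  simp [bridgeKernel]

/-- The bridge is pinned at the origin, so second moments of the kernel can be read off from its
increments. -/
lemma bridgeKernel_zero_ae : bridgeKernel 0 =ᵐ[uniformLaw] 0 := by
  have h : ∀ᵐ u ∂uniformLaw, u ≠ 1 := by
    unfold uniformLaw
    exact ae_restrict_of_ae (Measure.ae_ne volume 1)
  filter_upwards [ae_uniformLaw_mem, h] with u hu hu1
  rw [bridgeKernel_eq, Pi.zero_apply]
  have : ⌊0 - u⌋ = -1 := by
    rw [Int.floor_eq_iff]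
    push_cast
    constructor
    · linarith [hu.2]
    · linarith [hu.1]
  rw [this]
  norm_num

lemma integral_bridgeKernel_sq {s : ℝ} (hs : s ∈ Set.Icc (0 : ℝ) 1) :
    ∫ u, bridgeKernel s u ^ 2 ∂uniformLaw = s * (1 - s) := by
  have h := integral_bridgeKernel_sub_sq (s := 0) (t := s)
    (by rw [sub_zero, abs_of_nonneg hs.1]; exact hs.2)
  rw [sub_zero, abs_of_nonneg hs.1] at h
  rw [← h]
  refine integral_congr_ae ?_
  filter_upwards [bridgeKernel_zero_ae] with u hu
  simp [hu]

lemma integral_bridgeKernel_mul {s t : ℝ} (hs : s ∈ Set.Icc (0 : ℝ) 1)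
    (ht : t ∈ Set.Icc (0 : ℝ) 1) :
    ∫ u, bridgeKernel s u * bridgeKernel t u ∂uniformLaw = min s t - s * t := by
  have e : ∀ u, bridgeKernel s u * bridgeKernel t u = (bridgeKernel s u ^ 2 +
    bridgeKernel t u ^ 2 - (bridgeKernel t u - bridgeKernel s u) ^ 2) / 2 := fun u => by ring
  have h1 : |t - s| ≤ 1 := by
    rw [abs_le]; constructor <;> linarith [hs.1, hs.2, ht.1, ht.2]
  simp_rw [e]
  rw [integral_div, integral_sub, integral_add, integral_bridgeKernel_sub_sq h1,
    integral_bridgeKernel_sq hs, integral_bridgeKernel_sq ht]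
  · rcases le_total s t with h | h
    · rw [abs_of_nonneg (by linarith), min_eq_left h]; ring
    · rw [abs_of_nonpos (by linarith), min_eq_right h]; ring
  · exact (memLp_bridgeKernel s).integrable_sq
  · exact (memLp_bridgeKernel t).integrable_sq
  · exact (memLp_bridgeKernel s).integrable_sq.add (memLp_bridgeKernel t).integrable_sq
  · exact ((memLp_bridgeKernel t).sub (memLp_bridgeKernel s)).integrable_sq


/-! ### Displacements in terms of the empirical process -/

/-- The sum of `h` over the first `L` points. -/
def pointSum (L : ℕ) (h : ℝ → ℝ) (u : ℕ → ℝ) : ℝ := ∑ j ∈ Finset.range L, h (u j)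

lemma measurable_pointSum (L : ℕ) {h : ℝ → ℝ} (hh : Measurable h) : Measurable (pointSum L h) :=
  Finset.measurable_sum _ fun j _ => hh.comp (measurable_pi_apply j)

lemma pointSum_sub (L : ℕ) (g h : ℝ → ℝ) (u : ℕ → ℝ) :
    pointSum L (fun x => g x - h x) u = pointSum L g u - pointSum L h u :=
  Finset.sum_sub_distrib _ _

lemma pointSum_sawtooth (L : ℕ) (s : ℝ) (u : ℕ → ℝ) : pointSum L (sawtooth s) u =
    pointSum L (bridgeKernel s) u - pointSum L centredId u := by
  rw [← pointSum_sub]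
  congr 1
  ext x
  simp [bridgeKernel]

/-- The number of points below `s`, in its quasi-periodic extension. -/
lemma mul_sub_pointSum_eq (L : ℕ) (s : ℝ) (u : ℕ → ℝ) :
    L * s - pointSum L (bridgeKernel s) u = ∑ j ∈ Finset.range L, ((⌊s - u j⌋ : ℝ) + 1) := by
  simp only [pointSum, bridgeKernel_eq, Finset.sum_sub_distrib, Finset.sum_add_distrib]
  simp
  ring

/-- This is a counting function. Its monotonicity bounds the increase of `E` by a linear function,
which is how control at finitely many points becomes control in between. -/
lemma monotone_mul_sub_pointSum (L : ℕ) (u : ℕ → ℝ) :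
    Monotone fun s => L * s - pointSum L (bridgeKernel s) u := by
  intro s t hst
  simp only [mul_sub_pointSum_eq]
  refine Finset.sum_le_sum fun j _ => ?_
  gcongr

/-! ### Exact formulas and deterministic error bounds for the displacements -/

section Deterministic

variable {L : ℕ} [NeZero L] {u : ℕ → ℝ}

/-- The count of points up to and including the one of index `m` is `m + 1`, as indices start at
`0`. -/
lemma mul_sub_pointSum_blueLift (hb : Generic L (scalePoints L u)) (m : ℤ) :
    L * (blueLift L (scalePoints L u) m / L) -
      pointSum L (bridgeKernel (blueLift L (scalePoints L u) m / L)) u = m + 1 := by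
  have hL := realCast_pos_of_neZero L
  rw [mul_sub_pointSum_eq, ← Fin.sum_univ_eq_sum_range
    (fun j => ((⌊blueLift L (scalePoints L u) m / L - u j⌋ : ℝ) + 1)) L,
    ← Equiv.sum_comp (Tuple.sort (scalePoints L u))]
  set b := scalePoints L u with hbdef
  -- Each blue point contributes the number of completed turns, plus one if its rank does not exceed
  -- that of the current point.
  have hterm : ∀ k : Fin L, ((⌊blueLift L b m / L - u (Tuple.sort b k)⌋ : ℝ) + 1) =
      (if k ≤ residue L m then 1 else 0) + ((m / (L : ℤ) : ℤ) : ℝ) := by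
    intro k
    have e : blueLift L b m / L - u (Tuple.sort b k) =
        (b (Tuple.sort b (residue L m)) - b (Tuple.sort b k)) / L + ((m / (L : ℤ) : ℤ) : ℝ) := by
      rw [blueLift, periodicLift]
      have : b (Tuple.sort b k) = L * u (Tuple.sort b k) := rfl
      rw [this]
      field_simp
      ring
    rw [e, Int.floor_add_intCast]
    have h1 := hb.2 (Tuple.sort b (residue L m))
    have h2 := hb.2 (Tuple.sort b k)
    split_ifs with hk
    · have hle : b (Tuple.sort b k) ≤ b (Tuple.sort b (residue L m)) :=
        hb.strictMono_sort.monotone hk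
      have : ⌊(b (Tuple.sort b (residue L m)) - b (Tuple.sort b k)) / L⌋ = 0 := by
        rw [Int.floor_eq_zero_iff, Set.mem_Ico, div_lt_one hL]
        exact ⟨div_nonneg (by linarith) hL.le, by linarith [h1.2, h2.1]⟩
      rw [this]
      push_cast; ring
    · have hlt : b (Tuple.sort b (residue L m)) < b (Tuple.sort b k) :=
        hb.strictMono_sort (not_le.1 hk)
      have : ⌊(b (Tuple.sort b (residue L m)) - b (Tuple.sort b k)) / L⌋ = -1 := by
        rw [Int.floor_eq_iff]
        push_cast
        rw [le_div_iff₀ hL, neg_add_cancel, div_lt_iff₀ hL]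
        exact ⟨by linarith [h1.1, h2.2], by linarith⟩
      rw [this]
      push_cast; ring
  rw [Finset.sum_congr rfl fun k _ => hterm k, Finset.sum_add_distrib, Finset.sum_ite]
  have hcard : (Finset.univ.filter fun k : Fin L => k ≤ residue L m).card =
      (residue L m : ℕ) + 1 := by
    rw [← Fin.card_Iic]
    congr 1
    ext k; simp
  simp only [Finset.sum_const, hcard, Finset.card_univ, Fintype.card_fin]
  have h := congrArg (fun z : ℤ => (z : ℝ)) (eq_residue_add (L := L) m)
  push_cast at h
  conv_rhs => rw [h]
  simp
  ring

lemma orderedDisplacement_eq (hb : Generic L (scalePoints L u)) (i : Fin L) :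
    orderedDisplacement L (scalePoints L u) i =
      1 / 2 + pointSum L (bridgeKernel (blueLift L (scalePoints L u) i / L)) u := by
  have hL := realCast_pos_of_neZero L
  have h1 := blueLift_sub_eq (b := scalePoints L u) ((i : ℕ) : ℤ)
  have h2 := mul_sub_pointSum_blueLift hb ((i : ℕ) : ℤ)
  rw [residue_natCast] at h1
  rw [mul_div_cancel₀ _ hL.ne'] at h2
  linarith

/-- Solving the counting identity at the partner of `j` for its position. The `1/2` comes from the
half-integer red points against a count starting at one; the only obstacle left is the random
argument of the kernel. -/
lemma displacement_eq_pointSum (hb : Generic L (scalePoints L u)) (j : Fin L) :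
    displacement L (scalePoints L u) j = liftShift L (scalePoints L u) + 1 / 2 +
      pointSum L (bridgeKernel
        (blueLift L (scalePoints L u) (j + liftShift L (scalePoints L u)) / L)) u := by
  have hL := realCast_pos_of_neZero L
  have h1 := redPoint_add_displacement hb j
  have h2 := mul_sub_pointSum_blueLift hb ((j : ℕ) + liftShift L (scalePoints L u))
  rw [mul_div_cancel₀ _ hL.ne'] at h2
  rw [redPoint] at h1
  push_cast at h1 h2
  linarith

lemma abs_liftShift_add_pointSum_le (hb : Generic L (scalePoints L u)) :
    |(liftShift L (scalePoints L u) : ℝ) + pointSum L centredId u| ≤ 1 / 2 := by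
  have hL := realCast_pos_of_neZero L
  have h := abs_liftShift_add_le hb
  have e : (∑ j, (scalePoints L u j - L / 2)) / L = pointSum L centredId u := by
    rw [pointSum, ← Fin.sum_univ_eq_sum_range (fun j => centredId (u j)) L, Finset.sum_div]
    refine Finset.sum_congr rfl fun j _ => ?_
    rw [scalePoints, centredId]
    field_simp
  rwa [e] at h

/-- A function that increases slowly and is controlled on a grid is controlled everywhere. -/
lemma abs_sub_le_of_grid {E : ℝ → ℝ} {Λ : ℝ} (hE : Monotone fun s => Λ * s - E s) (hΛ : 0 ≤ Λ)
    {c δ a : ℝ} (hδ : 0 < δ) {M : ℕ}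
    (hgrid : ∀ k ∈ Finset.Icc (-(M : ℤ) - 1) (M + 1), |E (c + k * δ) - E c| ≤ a)
    {y : ℝ} (hy : |y - c| ≤ M * δ) : |E y - E c| ≤ a + Λ * δ := by
  have h1 : ⌊(y - c) / δ⌋ * δ ≤ y - c := by
    have := Int.floor_le ((y - c) / δ)
    rwa [le_div_iff₀ hδ] at this
  have h2 : y - c < (⌊(y - c) / δ⌋ + 1) * δ := by
    have := Int.lt_floor_add_one ((y - c) / δ)
    rwa [div_lt_iff₀ hδ] at this
  have hk1 : -(M : ℤ) ≤ ⌊(y - c) / δ⌋ := by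
    rw [Int.le_floor, le_div_iff₀ hδ]
    push_cast
    linarith [(abs_le.1 hy).1]
  have hk2 : ⌊(y - c) / δ⌋ ≤ M := by
    have : ⌊(y - c) / δ⌋ ≤ ⌊(M : ℝ)⌋ := by
      refine Int.floor_le_floor ?_
      rw [div_le_iff₀ hδ]
      exact (abs_le.1 hy).2
    simpa using this
  -- `y` lies between neighbouring grid points, and monotonicity from both sides costs at most `Λ *
  -- δ`. The neighbour `k + 1` explains the extra point in the grid range.
  set k := ⌊(y - c) / δ⌋
  have g1 := abs_le.1 (hgrid k (Finset.mem_Icc.2 ⟨by omega, by omega⟩))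
  have g2 := abs_le.1 (hgrid (k + 1) (Finset.mem_Icc.2 ⟨by omega, by omega⟩))
  have m1 := hE (show c + k * δ ≤ y by linarith)
  have m2 := hE (show y ≤ c + ((k + 1 : ℤ) : ℝ) * δ by push_cast; linarith)
  simp only at m1 m2
  rw [abs_le]
  push_cast at m2 g2
  have n1 : Λ * (y - (c + k * δ)) ≤ Λ * δ := by
    refine mul_le_mul_of_nonneg_left ?_ hΛ; linarith
  have n2 : Λ * (c + (k + 1) * δ - y) ≤ Λ * δ := by
    refine mul_le_mul_of_nonneg_left ?_ hΛ; linarith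
  constructor <;> linarith [g1.1, g1.2, g2.1, g2.2]

/-- Localization of the inverse of an almost linear function. -/
lemma abs_sub_le_of_monotone {E : ℝ → ℝ} {Λ : ℝ} (hE : Monotone fun s => Λ * s - E s)
    {c r A B : ℝ} (h1 : |E (c + r)| ≤ A) (h2 : |E (c - r)| ≤ A) (hr : A + B + 2 ≤ Λ * r)
    {y m : ℝ} (hy : Λ * y - E y = Λ * c + m + 1) (hm : |m| ≤ B) : |y - c| ≤ r := by
  have a1 := abs_le.1 h1
  have a2 := abs_le.1 h2
  have a3 := abs_le.1 hm
  rw [abs_le]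
  constructor
  · by_contra hlt
    have := hE (show y ≤ c - r by linarith)
    simp only at this
    linarith
  · by_contra hlt
    have := hE (show c + r ≤ y by linarith)
    simp only at this
    linarith

/-- The errors made when the displacements are replaced by sums over the points. -/
structure DisplacementApprox (L : ℕ) (u : ℕ → ℝ) (i : Fin L) (s a : ℝ) : Prop where
  ordered : |orderedDisplacement L (scalePoints L u) i - pointSum L (bridgeKernel s) u| ≤ a
  shift : |-(optimalShift L (scalePoints L u) : ℝ) - pointSum L centredId u| ≤ a
  displacement : |displacement L (scalePoints L u) i - pointSum L (sawtooth s) u| ≤ a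

/-- `R` is `√L`. Coarse bounds `K R` confine the relevant blue points to a window of radius `4 K /
R` around `i / L`; a grid of mesh `ε / R` covers it with `M` steps on each side. The error `4 ε R`
collects `2 ε R` from the window, `ε R` from replacing `i / L` by `s`, and at most `1 ≤ ε R` from
the two halves, the rounding of the shift and the index offset. -/
lemma displacementApprox_of_grid (hb : Generic L (scalePoints L u)) {R K ε s : ℝ} {M : ℕ}
    (hR : R ^ 2 = L) (hR0 : 0 < R) (hε : 0 < ε) (i : Fin L)
    (hM : 4 * K ≤ M * ε) (hKR : 3 ≤ K * R) (hRK : 2 * K + 2 ≤ R) (hεR : 1 ≤ ε * R)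
    (h1 : |pointSum L centredId u| ≤ K * R)
    (h2 : |pointSum L (bridgeKernel (i / L + 4 * K / R)) u| ≤ K * R)
    (h3 : |pointSum L (bridgeKernel (i / L - 4 * K / R)) u| ≤ K * R)
    (h4 : ∀ k ∈ Finset.Icc (-(M : ℤ) - 1) (M + 1),
      |pointSum L (bridgeKernel (i / L + k * (ε / R))) u - pointSum L (bridgeKernel (i / L)) u| ≤
        ε * R)
    (h5 : |pointSum L (bridgeKernel (i / L)) u - pointSum L (bridgeKernel s) u| ≤ ε * R) :
    DisplacementApprox L u i s (4 * (ε * R)) := by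
  have hL := realCast_pos_of_neZero L
  set q := liftShift L (scalePoints L u) with hq
  have hK : 0 < K := by
    by_contra h
    nlinarith
  have hshift := abs_le.1 (abs_liftShift_add_pointSum_le hb)
  rw [← hq] at hshift
  have h1' := abs_le.1 h1
  have hqabs : |(q : ℝ)| ≤ K * R + 1 := by
    rw [abs_le]; constructor <;> linarith
  have hLc : (L : ℝ) * (i / L) = i := mul_div_cancel₀ _ hL.ne'
  have hloc : ∀ m : ℤ, |(m : ℝ)| ≤ K * R + 1 →
      |pointSum L (bridgeKernel (blueLift L (scalePoints L u) (i + m) / L)) u -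
        pointSum L (bridgeKernel (i / L)) u| ≤ 2 * (ε * R) := by
    intro m hm
    have hmul := mul_sub_pointSum_blueLift hb ((i : ℕ) + m)
    have hclose := abs_sub_le_of_monotone (monotone_mul_sub_pointSum L u) h2 h3
      (B := K * R + 1) (m := m)
      (y := blueLift L (scalePoints L u) (i + m) / L) (by
        -- The localization needs `K R + (K R + 1) + 2 ≤ 4 K R`, which follows from `3 ≤ K R`.
        have : (L : ℝ) * (4 * K / R) = 4 * (K * R) := by
          rw [← hR]; field_simp
        rw [this]; linarith)
      (by rw [hmul, hLc]; push_cast; ring) hm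
    have hMδ : 4 * K / R ≤ M * (ε / R) := by
      rw [← mul_div_assoc]
      gcongr
    have hgrid := abs_sub_le_of_grid (monotone_mul_sub_pointSum L u) hL.le (by positivity) h4
      (hclose.trans hMδ)
    have : (L : ℝ) * (ε / R) = ε * R := by
      rw [← hR]; field_simp
    rw [this] at hgrid
    linarith
  have e5 := abs_le.1 h5
  -- `|q| ≤ K R + 1` is below `L / 2`, so reduction modulo `L` leaves the shift unchanged.
  have hbmod : optimalShift L (scalePoints L u) = q := by
    rw [optimalShift_eq hb, ← hq]
    have hlt : 2 * |(q : ℝ)| < L := by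
      rw [← hR]
      nlinarith
    have hlt' : 2 * |q| < (L : ℤ) := by exact_mod_cast hlt
    rw [← abs_two, ← abs_mul, abs_lt] at hlt'
    exact Int.bmod_eq_of_le (by omega) (by omega)
  refine ⟨?_, ?_, ?_⟩
  · rw [orderedDisplacement_eq hb]
    have := hloc 0 (by simp; positivity)
    rw [add_zero] at this
    rw [abs_le] at this ⊢
    constructor <;> linarith
  · rw [hbmod, abs_le]
    constructor <;> linarith
  · rw [displacement_eq_pointSum hb, pointSum_sawtooth, ← hq]
    have := abs_le.1 (hloc q hqabs)
    rw [abs_le]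
    constructor <;> linarith

end Deterministic

/-! ### The approximation holds with high probability -/

lemma ae_generic_scalePoints (L : ℕ) [NeZero L] :
    ∀ᵐ u ∂uniformSeq, Generic L (scalePoints L u) := by
  have := ae_generic L
  rw [← map_scalePoints_uniformSeq] at this
  exact ae_of_ae_map (measurable_scalePoints L).aemeasurable this

lemma measureReal_lt_abs_pointSum {h : ℝ → ℝ} (hh : Measurable h) (hL : MemLp h 2 uniformLaw)
    (h0 : ∫ x, h x ∂uniformLaw = 0) (n : ℕ) {a v : ℝ} (ha : 0 < a)
    (hv : ∫ x, h x ^ 2 ∂uniformLaw ≤ v) :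
    uniformSeq.real {u | a < |pointSum n h u|} ≤ n * v / a ^ 2 :=
  (measureReal_mono (Set.ofPred_subset_ofPred.2 fun _ hu => le_of_lt hu)).trans
    (measureReal_le_abs_sum hh hL h0 n ha hv)

lemma measureReal_lt_abs_pointSum_bridgeKernel (s : ℝ) (n : ℕ) {a : ℝ} (ha : 0 < a) :
    uniformSeq.real {u | a < |pointSum n (bridgeKernel s) u|} ≤ n / a ^ 2 := by
  refine (measureReal_lt_abs_pointSum (measurable_bridgeKernel s) (memLp_bridgeKernel s)
    (integral_bridgeKernel s) n ha (integral_sq_le_one (memLp_bridgeKernel s) ?_)).trans_eq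
      (by rw [mul_one])
  filter_upwards [ae_uniformLaw_mem] with u hu using abs_bridgeKernel_le hu s

lemma measureReal_lt_abs_pointSum_centredId (n : ℕ) {a : ℝ} (ha : 0 < a) :
    uniformSeq.real {u | a < |pointSum n centredId u|} ≤ n / a ^ 2 :=
  (measureReal_lt_abs_pointSum measurable_centredId memLp_centredId
    integral_centredId n ha (v := 1) (by rw [integral_centredId_sq]; norm_num)).trans_eq
      (by rw [mul_one])

lemma measureReal_lt_abs_pointSum_sub {s t : ℝ} (h1 : |t - s| ≤ 1) (n : ℕ) {a : ℝ} (ha : 0 < a) :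
    uniformSeq.real {u | a < |pointSum n (bridgeKernel t) u - pointSum n (bridgeKernel s) u|} ≤
      n * |t - s| / a ^ 2 := by
  simp_rw [← pointSum_sub]
  refine measureReal_lt_abs_pointSum ((measurable_bridgeKernel t).sub (measurable_bridgeKernel s))
    ((memLp_bridgeKernel t).sub (memLp_bridgeKernel s)) ?_ n ha ?_
  · simp only [Pi.sub_apply]
    rw [integral_sub ((memLp_bridgeKernel t).integrable one_le_two)
      ((memLp_bridgeKernel s).integrable one_le_two), integral_bridgeKernel, integral_bridgeKernel,
      sub_zero]
  · simp only [Pi.sub_apply]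
    rw [integral_bridgeKernel_sub_sq h1]
    nlinarith [abs_nonneg (t - s)]

/-- Union bound: three coarse bounds cost `1 / K^2` each, and the `2 M + 3` grid points cost `(M +
1) / (ε R)` each because an increment over distance `h` has variance at most `L h`. The last term
pays for moving from `i / L` to `s`. -/
lemma measureReal_not_displacementApprox_le {L : ℕ} [NeZero L] {R K ε s : ℝ} {M : ℕ}
    (hR : R ^ 2 = L) (hR0 : 0 < R) (hε : 0 < ε) (i : Fin L)
    (hM : 4 * K ≤ M * ε) (hKR : 3 ≤ K * R) (hRK : 2 * K + 2 ≤ R) (hεR : 1 ≤ ε * R)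
    (hMR : (M + 1) * ε ≤ R) (hs : |(i : ℝ) / L - s| ≤ 1) :
    uniformSeq.real {u | ¬ DisplacementApprox L u i s (4 * (ε * R))} ≤
      3 / K ^ 2 + (2 * M + 3) * (M + 1) / (ε * R) + |(i : ℝ) / L - s| / ε ^ 2 := by
  have hK : 0 < K := by
    by_contra h
    nlinarith
  have hKR0 : 0 < K * R := by positivity
  have hsub : {u | ¬ DisplacementApprox L u i s (4 * (ε * R))} ⊆
      {u | ¬ Generic L (scalePoints L u)} ∪
      ({u | K * R < |pointSum L centredId u|} ∪
      ({u | K * R < |pointSum L (bridgeKernel (i / L + 4 * K / R)) u|} ∪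
      ({u | K * R < |pointSum L (bridgeKernel (i / L - 4 * K / R)) u|} ∪
      ((⋃ k ∈ Finset.Icc (-(M : ℤ) - 1) (M + 1), {u | ε * R <
        |pointSum L (bridgeKernel (i / L + k * (ε / R))) u - pointSum L (bridgeKernel (i / L)) u|}) ∪
      {u | ε * R < |pointSum L (bridgeKernel (i / L)) u - pointSum L (bridgeKernel s) u|})))) := by
    intro u hu
    by_contra hcon
    simp only [Set.mem_union, Set.mem_ofPred_eq, Set.mem_iUnion, not_or, not_not, not_lt,
      exists_prop, not_exists, not_and] at hcon
    obtain ⟨c0, c1, c2, c3, c4, c5⟩ := hcon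
    exact hu (displacementApprox_of_grid c0 hR hR0 hε i hM hKR hRK hεR c1 c2 c3 c4 c5)
  have b0 : uniformSeq.real {u | ¬ Generic L (scalePoints L u)} = 0 := by
    rw [measureReal_def, ae_iff.1 (ae_generic_scalePoints L)]
    simp
  have eK : (L : ℝ) / (K * R) ^ 2 = 1 / K ^ 2 := by
    rw [← hR]; field_simp
  have b1 := measureReal_lt_abs_pointSum_centredId L hKR0
  have b2 := measureReal_lt_abs_pointSum_bridgeKernel (i / L + 4 * K / R) L hKR0
  have b3 := measureReal_lt_abs_pointSum_bridgeKernel (i / L - 4 * K / R) L hKR0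
  rw [eK] at b1 b2 b3
  have b4 : uniformSeq.real (⋃ k ∈ Finset.Icc (-(M : ℤ) - 1) (M + 1), {u | ε * R <
        |pointSum L (bridgeKernel (i / L + k * (ε / R))) u - pointSum L (bridgeKernel (i / L)) u|}) ≤
      (2 * M + 3) * (M + 1) / (ε * R) := by
    refine (measureReal_biUnion_finset_le _ _).trans ?_
    have hk : ∀ k ∈ Finset.Icc (-(M : ℤ) - 1) (M + 1), uniformSeq.real {u | ε * R <
        |pointSum L (bridgeKernel (i / L + k * (ε / R))) u - pointSum L (bridgeKernel (i / L)) u|} ≤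
        (M + 1) / (ε * R) := by
      intro k hk
      rw [Finset.mem_Icc] at hk
      have hkM : |(k : ℝ)| ≤ M + 1 := by
        rw [abs_le]
        constructor
        · have : ((-(M : ℤ) - 1 : ℤ) : ℝ) ≤ k := by exact_mod_cast hk.1
          push_cast at this; linarith
        · exact_mod_cast hk.2
      have hd : |(i : ℝ) / L + k * (ε / R) - i / L| = |(k : ℝ)| * (ε / R) := by
        rw [add_sub_cancel_left, abs_mul, abs_of_pos (by positivity : 0 < ε / R)]
      refine (measureReal_lt_abs_pointSum_sub (s := (i : ℝ) / L) ?_ L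
        (by positivity : 0 < ε * R)).trans ?_
      · rw [hd, ← mul_div_assoc, div_le_one hR0]
        exact (mul_le_mul_of_nonneg_right hkM hε.le).trans hMR
      · rw [hd, ← hR]
        have : R ^ 2 * (|(k : ℝ)| * (ε / R)) / (ε * R) ^ 2 = |(k : ℝ)| / (ε * R) := by
          field_simp
        rw [this]
        gcongr
    refine (Finset.sum_le_sum hk).trans_eq ?_
    rw [Finset.sum_const, Int.card_Icc, nsmul_eq_mul]
    have : (((M : ℤ) + 1 + 1 - (-(M : ℤ) - 1)).toNat : ℝ) = 2 * M + 3 := by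
      have : ((M : ℤ) + 1 + 1 - (-(M : ℤ) - 1)).toNat = 2 * M + 3 := by omega
      rw [this]; push_cast; ring
    rw [this]
    ring
  have b5 : uniformSeq.real {u | ε * R <
      |pointSum L (bridgeKernel (i / L)) u - pointSum L (bridgeKernel s) u|} ≤
        |(i : ℝ) / L - s| / ε ^ 2 := by
    refine (measureReal_lt_abs_pointSum_sub hs L (by positivity : 0 < ε * R)).trans_eq ?_
    rw [← hR]; field_simp
  refine (measureReal_mono hsub).trans ?_
  refine (measureReal_union_le _ _).trans ?_
  grw [measureReal_union_le, measureReal_union_le, measureReal_union_le, measureReal_union_le,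
    b0, b1, b2, b3, b4, b5]
  apply le_of_eq
  ring

/-- Uniformly in the index, the displacements are close to sums over independent points. -/
theorem exists_displacementApprox {ε δ : ℝ} (hε : 0 < ε) (hδ : 0 < δ) :
    ∃ η > 0, ∀ᶠ L : ℕ in atTop, ∀ (i : Fin L) (s : ℝ), |(i : ℝ) / L - s| ≤ η →
      uniformSeq.real {u | ¬ DisplacementApprox L u i s (ε * √L)} ≤ δ := by
  have hε4 : 0 < ε / 4 := by positivity
  -- The failure probability splits into three parts of size `δ / 3`; this `K` takes care of `3 /
  -- K^2`.
  set K : ℝ := 1 + 9 / δ with hK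
  have hK0 : 0 < K := by positivity
  have hKδ : 3 / K ^ 2 ≤ δ / 3 := by
    rw [div_le_iff₀ (by positivity), hK]
    have : δ / 3 * (1 + 9 / δ) ^ 2 = δ / 3 + 6 + 27 / δ := by field_simp; ring
    rw [this]
    have : 0 < 27 / δ := by positivity
    linarith
  obtain ⟨M, hM⟩ := exists_nat_ge (4 * K / (ε / 4))
  rw [div_le_iff₀ hε4] at hM
  -- The bound `1` permits the variance formula for increments; the other entry makes the cost of
  -- moving to `s` at most `δ / 3`.
  refine ⟨min 1 (δ / 3 * (ε / 4) ^ 2), by positivity, ?_⟩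
  have hsqrt : Tendsto (fun L : ℕ => √(L : ℝ)) atTop atTop :=
    Real.tendsto_sqrt_atTop.comp tendsto_natCast_atTop_atTop
  filter_upwards [hsqrt.eventually_ge_atTop (3 / K), hsqrt.eventually_ge_atTop (2 * K + 2),
    hsqrt.eventually_ge_atTop (1 / (ε / 4)), hsqrt.eventually_ge_atTop ((M + 1) * (ε / 4)),
    hsqrt.eventually_ge_atTop ((2 * M + 3) * (M + 1) / (ε / 4) / (δ / 3)),
    eventually_gt_atTop 0] with L h1 h2 h3 h4 h5 hL i s hs
  have : NeZero L := ⟨hL.ne'⟩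
  have hR0 : 0 < √(L : ℝ) := Real.sqrt_pos.2 (by exact_mod_cast hL)
  rw [div_le_iff₀' hK0] at h1
  rw [div_le_iff₀' hε4] at h3
  rw [div_le_iff₀ (by positivity)] at h5
  have key := measureReal_not_displacementApprox_le (s := s) (Real.sq_sqrt (Nat.cast_nonneg L)) hR0
    hε4 i hM h1 h2 h3 h4 (hs.trans (min_le_left _ _))
  have e : 4 * (ε / 4 * √(L : ℝ)) = ε * √L := by ring
  rw [e] at key
  have k1 : (2 * M + 3) * (M + 1) / (ε / 4 * √(L : ℝ)) ≤ δ / 3 := by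
    rw [← div_div, div_le_iff₀ hR0, mul_comm (δ / 3)]
    exact h5
  have k2 : |(i : ℝ) / L - s| / (ε / 4) ^ 2 ≤ δ / 3 := by
    rw [div_le_iff₀ (by positivity)]
    exact hs.trans (min_le_right _ _)
  linarith


/-! ### The multivariate central limit theorem for sums over the points -/

lemma charFun_map_toLp {ι Ω : Type*} [Fintype ι] {mΩ : MeasurableSpace Ω} {μ : Measure Ω}
    {Z : Ω → ι → ℝ} (hZ : AEMeasurable Z μ) (t : EuclideanSpace ℝ ι) :
    charFun (μ.map fun ω => WithLp.toLp 2 (Z ω)) t =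
      charFun (μ.map fun ω => ∑ i, t i * Z ω i) 1 := by
  have h1 : AEMeasurable (fun ω => WithLp.toLp 2 (Z ω)) μ :=
    (WithLp.measurable_toLp 2 (ι → ℝ)).comp_aemeasurable hZ
  have hZi : ∀ i, AEMeasurable (fun ω => Z ω i) μ := fun i => aemeasurable_pi_iff.1 hZ i
  have h2 : AEMeasurable (fun ω => ∑ i, t i * Z ω i) μ :=
    Finset.aemeasurable_fun_sum _ fun i _ => (hZi i).const_mul _
  rw [charFun_apply, charFun_apply, integral_map h1 (by fun_prop), integral_map h2 (by fun_prop)]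
  congr 1
  ext ω
  simp [PiLp.inner_apply]

/-- Central limit theorem for a centred function of the points. -/
lemma tendsto_charFun_pointSum {g : ℝ → ℝ} (hg : Measurable g) (hL : MemLp g 2 uniformLaw)
    (h0 : ∫ x, g x ∂uniformLaw = 0) (t : ℝ) :
    Tendsto (fun L : ℕ => charFun (uniformSeq.map fun u => (√(L : ℝ))⁻¹ * pointSum L g u) t) atTop
      (𝓝 (charFun (gaussianReal 0 (∫ x, g x ^ 2 ∂uniformLaw).toNNReal) t)) := by
  have hmean : ∫ u, g (u 0) ∂uniformSeq = 0 := by rw [integral_uniformSeq_eval hg, h0]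
  have hvar : Var[fun u : ℕ → ℝ => g (u 0); uniformSeq] = ∫ x, g x ^ 2 ∂uniformLaw := by
    rw [variance_of_integral_eq_zero (memLp_uniformSeq_eval hL 0).aemeasurable hmean]
    exact integral_uniformSeq_eval (hg.pow_const 2) 0
  have h := tendstoInDistribution_inv_sqrt_mul_sum_sub
    (P := uniformSeq) (X := fun j u => g (u j)) (Y := id)
    (P' := gaussianReal 0 (∫ x, g x ^ 2 ∂uniformLaw).toNNReal)
    ⟨by fun_prop, by rw [Measure.map_id, hvar]⟩ (memLp_uniformSeq_eval hL 0)
    (iIndepFun_uniformSeq hg) (fun j =>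
      ⟨(hg.comp (measurable_pi_apply j)).aemeasurable,
        (hg.comp (measurable_pi_apply 0)).aemeasurable, by
          rw [map_comp_eval_uniformSeq hg, map_comp_eval_uniformSeq hg]⟩)
  have h2 := ProbabilityMeasure.tendsto_iff_tendsto_charFun.1 h.tendsto t
  simp only [hmean, mul_zero, sub_zero, ProbabilityMeasure.coe_mk, Measure.map_id] at h2
  exact h2

/-- Cramér–Wold: the multivariate characteristic function at `t` is that of a scalar combination at
`1`, so the scalar central limit theorem suffices. The limit enters only through the laws of its
linear combinations, so the bridge and an explicit Gaussian pair can both serve. -/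
theorem tendstoInDistribution_pointSum {ι Ω : Type*} [Fintype ι] {mΩ : MeasurableSpace Ω}
    {μ : Measure Ω} [IsProbabilityMeasure μ] {h : ι → ℝ → ℝ} (hh : ∀ i, Measurable (h i))
    (hL : ∀ i, MemLp (h i) 2 uniformLaw) (h0 : ∀ i, ∫ x, h i x ∂uniformLaw = 0)
    {Z : Ω → ι → ℝ} (hZm : AEMeasurable Z μ)
    (hZ : ∀ θ : ι → ℝ, μ.map (fun ω => ∑ i, θ i * Z ω i) =
      gaussianReal 0 (∫ u, (∑ i, θ i * h i u) ^ 2 ∂uniformLaw).toNNReal) :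
    TendstoInDistribution (fun (L : ℕ) u i => (√(L : ℝ))⁻¹ * pointSum L (h i) u) atTop Z
      (fun _ => uniformSeq) μ := by
  have hm : ∀ L : ℕ, Measurable fun u i => (√(L : ℝ))⁻¹ * pointSum L (h i) u := fun L =>
    measurable_pi_lambda _ fun i => (measurable_pointSum L (hh i)).const_mul _
  have key : TendstoInDistribution
      (fun (L : ℕ) u => WithLp.toLp 2 fun i => (√(L : ℝ))⁻¹ * pointSum L (h i) u) atTop
      (fun ω => WithLp.toLp 2 (Z ω)) (fun _ => uniformSeq) μ := by
    refine ⟨fun L => ((WithLp.measurable_toLp 2 (ι → ℝ)).comp (hm L)).aemeasurable,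
      (WithLp.measurable_toLp 2 (ι → ℝ)).comp_aemeasurable hZm, ?_⟩
    refine ProbabilityMeasure.tendsto_iff_tendsto_charFun.2 fun t => ?_
    simp only [ProbabilityMeasure.coe_mk]
    rw [charFun_map_toLp hZm, hZ]
    refine (tendsto_charFun_pointSum (g := fun x => ∑ i, t i * h i x)
      (Finset.measurable_fun_sum _ fun i _ => (hh i).const_mul _)
      (memLp_finsetSum _ fun i _ => (hL i).const_mul _) ?_ 1).congr fun L => ?_
    · rw [integral_finsetSum _ fun i _ => ((hL i).const_mul _).integrable one_le_two]
      exact Finset.sum_eq_zero fun i _ => by rw [integral_const_mul, h0, mul_zero]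
    · rw [charFun_map_toLp (hm L).aemeasurable]
      congr 2
      ext u
      simp only [pointSum, Finset.mul_sum]
      rw [Finset.sum_comm]
      exact Finset.sum_congr rfl fun i _ => Finset.sum_congr rfl fun j _ => by ring
  exact key.continuous_comp (PiLp.continuous_ofLp 2 fun _ : ι => ℝ)

/-! ### Convergence in probability of the displacements -/

lemma tendstoInMeasure_of_real {Ω E : Type*} {mΩ : MeasurableSpace Ω} {μ : Measure Ω}
    [IsFiniteMeasure μ] [SeminormedAddCommGroup E] {f : ℕ → Ω → E}
    (h : ∀ ε > 0, ∀ δ > 0, ∀ᶠ n in atTop, μ.real {ω | ε ≤ ‖f n ω‖} ≤ δ) :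
    TendstoInMeasure μ f atTop 0 := by
  rw [tendstoInMeasure_iff_measureReal_norm]
  intro ε hε
  simp only [Pi.zero_apply, sub_zero]
  rw [Metric.tendsto_nhds]
  intro δ hδ
  filter_upwards [h ε hε (δ / 2) (by positivity)] with n hn
  rw [Real.dist_eq, sub_zero, abs_of_nonneg measureReal_nonneg]
  linarith

/-- Along any sequence of sizes and indices, the three rescaled quantities are asymptotic to
normalized sums over independent points. -/
lemma eventually_measureReal_not_displacementApprox {N : ℕ → ℕ} (hN : Tendsto N atTop atTop)
    {i : ∀ n, Fin (N n)} {s : ℝ}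
    (hi : Tendsto (fun n => ((i n : ℕ) : ℝ) / (N n : ℝ)) atTop (𝓝 s))
    {ε δ : ℝ} (hε : 0 < ε) (hδ : 0 < δ) :
    ∀ᶠ n in atTop, uniformSeq.real {u | ¬ DisplacementApprox (N n) u (i n) s (ε * √(N n))} ≤ δ := by
  obtain ⟨η, hη, h⟩ := exists_displacementApprox hε hδ
  filter_upwards [hN.eventually h, Metric.tendsto_nhds.1 hi η hη] with n h1 h2
  exact h1 (i n) s (by rw [← Real.dist_eq]; exact h2.le)


/-! ### Riemann sums -/

lemma intervalIntegral_comp_floor_succ (F : ℤ → ℝ) (k : ℕ) :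
    IntervalIntegrable (fun y : ℝ => F ⌊y⌋) volume k (k + 1) ∧
      ∫ y in (k : ℝ)..(k + 1), F ⌊y⌋ = F k := by
  have hle : (k : ℝ) ≤ k + 1 := by linarith
  have hfl : ∀ y ∈ Set.Ico (k : ℝ) (k + 1), F k = F ⌊y⌋ := by
    intro y hy
    have : ⌊y⌋ = (k : ℤ) := Int.floor_eq_iff.2 ⟨by exact_mod_cast hy.1, by exact_mod_cast hy.2⟩
    rw [this]
  constructor
  · rw [intervalIntegrable_iff_integrableOn_Ico_of_le hle]
    exact (integrableOn_const (by simp)).congr_fun hfl measurableSet_Ico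
  · rw [intervalIntegral.integral_of_le hle, ← integral_Ico_eq_integral_Ioc,
      ← setIntegral_congr_fun measurableSet_Ico hfl]
    simp

lemma intervalIntegral_comp_floor_mul (F : ℤ → ℝ) {n : ℕ} (hn : n ≠ 0) :
    ∫ x in (0 : ℝ)..1, F ⌊(n : ℝ) * x⌋ = (n : ℝ)⁻¹ * ∑ k ∈ Finset.range n, F k := by
  have hn' : (n : ℝ) ≠ 0 := by exact_mod_cast hn
  rw [intervalIntegral.integral_comp_mul_left (fun y => F ⌊y⌋) hn', smul_eq_mul, mul_zero, mul_one]
  congr 1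
  have h := intervalIntegral.sum_integral_adjacent_intervals (f := fun y : ℝ => F ⌊y⌋)
    (μ := volume) (a := fun k : ℕ => (k : ℝ)) (n := n) fun k _ => by
      push_cast; exact (intervalIntegral_comp_floor_succ F k).1
  rw [Nat.cast_zero] at h
  rw [← h]
  refine Finset.sum_congr rfl fun k _ => ?_
  push_cast
  exact (intervalIntegral_comp_floor_succ F k).2

/-- Riemann sums of bounded almost everywhere continuous functions converge. -/
theorem tendsto_riemannSum {f : ℝ → ℝ} {C : ℝ} (hC : ∀ x, |f x| ≤ C)
    (hf : ∀ᵐ x ∂(volume : Measure ℝ), ContinuousAt f x) :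
    Tendsto (fun n : ℕ => (n : ℝ)⁻¹ * ∑ k ∈ Finset.range n, f (k / n)) atTop
      (𝓝 (∫ x in (0 : ℝ)..1, f x)) := by
  -- A Riemann sum is the integral of a step function, so dominated convergence applies at points of
  -- continuity.
  have h : Tendsto (fun n : ℕ => ∫ x in (0 : ℝ)..1, f (⌊(n : ℝ) * x⌋ / n)) atTop
      (𝓝 (∫ x in (0 : ℝ)..1, f x)) := by
    refine intervalIntegral.tendsto_integral_filter_of_dominated_convergence (fun _ => C) ?_ ?_ ?_ ?_
    · refine Eventually.of_forall fun n => Measurable.aestronglyMeasurable ?_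
      exact (measurable_of_countable fun k : ℤ => f (k / n)).comp
        (Int.measurable_floor.comp (by fun_prop))
    · exact Eventually.of_forall fun n => ae_of_all _ fun x _ => hC _
    · exact intervalIntegrable_const
    · filter_upwards [hf] with x hx _
      refine hx.tendsto.comp ?_
      have hinv : Tendsto (fun n : ℕ => (n : ℝ)⁻¹) atTop (𝓝 0) :=
        tendsto_inv_atTop_zero.comp tendsto_natCast_atTop_atTop
      have hlow : Tendsto (fun n : ℕ => x - (n : ℝ)⁻¹) atTop (𝓝 x) := by
        simpa using tendsto_const_nhds.sub hinv
      refine tendsto_of_tendsto_of_tendsto_of_le_of_le' hlow tendsto_const_nhds ?_ ?_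
      · filter_upwards [eventually_gt_atTop 0] with n hn
        have hn' : (0 : ℝ) < n := by exact_mod_cast hn
        rw [le_div_iff₀ hn', sub_mul, inv_mul_cancel₀ hn'.ne']
        linarith [Int.sub_one_lt_floor ((n : ℝ) * x)]
      · filter_upwards [eventually_gt_atTop 0] with n hn
        have hn' : (0 : ℝ) < n := by exact_mod_cast hn
        rw [div_le_iff₀ hn', mul_comm x]
        exact Int.floor_le _
  refine h.congr' ?_
  filter_upwards [eventually_ne_atTop 0] with n hn
  have := intervalIntegral_comp_floor_mul (fun k : ℤ => f (k / n)) hn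
  rw [this]
  simp

/-- The point `k / n` of the unit interval. -/
def gridPoint (n : ℕ) (k : Fin n) : unitInterval :=
  ⟨(k : ℝ) / n, by positivity, by
    have : (0 : ℝ) < n := by exact_mod_cast k.pos
    rw [div_le_one this]
    exact_mod_cast k.isLt.le⟩

lemma pathMean_eq (f : unitInterval → ℝ) :
    pathMean f = ∫ x in (0 : ℝ)..1, Set.IccExtend zero_le_one f x := by
  rw [intervalIntegral.integral_of_le zero_le_one, ← integral_Icc_eq_integral_Ioc,
    ← integral_subtype_comap measurableSet_Icc]
  unfold pathMean
  congr 1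
  ext s
  exact (Set.IccExtend_val zero_le_one f s).symm

lemma exists_abs_le_of_continuous {f : unitInterval → ℝ} (hf : Continuous f) :
    ∃ C, ∀ s, |f s| ≤ C := by
  obtain ⟨C, hC⟩ := isCompact_univ.exists_bound_of_continuousOn hf.continuousOn
  exact ⟨C, fun s => hC s (Set.mem_univ s)⟩

lemma tendsto_riemannSum_pathMean {f : unitInterval → ℝ} (hf : Continuous f) :
    Tendsto (fun n : ℕ => (n : ℝ)⁻¹ * ∑ k : Fin n, f (gridPoint n k)) atTop
      (𝓝 (pathMean f)) := by
  obtain ⟨C, hC⟩ := exists_abs_le_of_continuous hf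
  have h := tendsto_riemannSum (f := Set.IccExtend zero_le_one f) (C := C) (fun x => hC _)
    (ae_of_all _ fun x => (hf.Icc_extend' (h := zero_le_one)).continuousAt)
  rw [pathMean_eq]
  refine h.congr fun n => ?_
  congr 1
  rw [← Fin.sum_univ_eq_sum_range (fun k => Set.IccExtend zero_le_one f ((k : ℝ) / n)) n]
  refine Finset.sum_congr rfl fun k _ => ?_
  exact Set.IccExtend_val zero_le_one f (gridPoint n k)

/-- As a function of its first argument the kernel jumps only on `u + ℤ`, and its sawtooth part
integrates to zero over a period. Hence `centredId` represents the mean of the bridge. -/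
lemma tendsto_riemannSum_bridgeKernel {u : ℝ} (hu : u ∈ Set.Ioc (0 : ℝ) 1) :
    Tendsto (fun n : ℕ => (n : ℝ)⁻¹ * ∑ k : Fin n, bridgeKernel (gridPoint n k) u) atTop
      (𝓝 (centredId u)) := by
  have hcont : ∀ᵐ x ∂(volume : Measure ℝ), ContinuousAt (fun x => bridgeKernel x u) x := by
    have hc : (Set.range fun k : ℤ => u + k).Countable := Set.countable_range _
    filter_upwards [hc.ae_notMem volume] with x hx
    unfold bridgeKernel sawtooth
    refine ContinuousAt.add (ContinuousAt.sub ?_ continuousAt_const) continuousAt_const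
    refine ContinuousAt.comp (g := Int.fract) (continuousAt_fract fun h => hx ?_) (by fun_prop)
    exact ⟨⌊x - u⌋, by simp only; linarith⟩
  have h := tendsto_riemannSum (fun x => abs_bridgeKernel_le hu x) hcont
  have hint : ∫ x in (0 : ℝ)..1, bridgeKernel x u = centredId u := by
    unfold bridgeKernel sawtooth
    have hper : Function.Periodic (fun x : ℝ => Int.fract x - 1 / 2 + centredId u) 1 :=
      fun x => by simp
    rw [intervalIntegral.integral_comp_sub_right
      (fun x => Int.fract x - 1 / 2 + centredId u) u]
    have e := hper.intervalIntegral_add_eq (0 - u) 0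
    rw [show (0 : ℝ) - u + 1 = 1 - u by ring, zero_add] at e
    rw [e, intervalIntegral_comp_fract fun x => x - 1 / 2 + centredId u]
    rw [intervalIntegral.integral_add (Continuous.intervalIntegrable (by fun_prop) _ _)
      intervalIntegrable_const]
    norm_num [integral_id]
  rw [hint] at h
  refine h.congr fun n => ?_
  congr 1
  rw [← Fin.sum_univ_eq_sum_range (fun k => bridgeKernel ((k : ℝ) / n) u) n]
  rfl

/-! ### Linear functionals of the Brownian bridge -/

/-- Almost sure limits of centred Gaussian variables are Gaussian. -/
lemma map_eq_gaussianReal_of_ae_tendsto {Ω : Type*} {mΩ : MeasurableSpace Ω} {μ : Measure Ω}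
    [IsProbabilityMeasure μ] {X : ℕ → Ω → ℝ} {Y : Ω → ℝ} {v : ℕ → NNReal} {w : NNReal}
    (hX : ∀ n, AEMeasurable (X n) μ) (hY : AEMeasurable Y μ)
    (hlaw : ∀ n, μ.map (X n) = gaussianReal 0 (v n))
    (hlim : ∀ᵐ ω ∂μ, Tendsto (fun n => X n ω) atTop (𝓝 (Y ω)))
    (hv : Tendsto v atTop (𝓝 w)) : μ.map Y = gaussianReal 0 w := by
  have : IsProbabilityMeasure (μ.map Y) := Measure.isProbabilityMeasure_map hY
  refine Measure.ext_of_charFun ?_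
  ext t
  have h := ProbabilityMeasure.tendsto_iff_tendsto_charFun.1
    (tendstoInDistribution_of_ae_tendsto hX hY hlim).tendsto t
  simp only [ProbabilityMeasure.coe_mk, hlaw, charFun_gaussianReal] at h
  refine tendsto_nhds_unique h ?_
  rw [charFun_gaussianReal]
  have hv' : Tendsto (fun n => ((v n : ℝ) : ℂ)) atTop (𝓝 ((w : ℝ) : ℂ)) :=
    (Complex.continuous_ofReal.tendsto _).comp ((NNReal.continuous_coe.tendsto _).comp hv)
  exact (Complex.continuous_exp.tendsto _).comp
    (tendsto_const_nhds.sub ((hv'.mul_const _).div_const 2))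

lemma abs_unitInterval_sub_le (s t : unitInterval) : |(t : ℝ) - s| ≤ 1 := by
  rw [abs_le]
  constructor <;> linarith [s.2.1, s.2.2, t.2.1, t.2.2]

lemma integral_sawtooth_combo (s t : unitInterval) (a b : ℝ) :
    ∫ u, (a * sawtooth s u + b * sawtooth t u) ^ 2 ∂uniformLaw = (a ^ 2 + b ^ 2) / 12 +
      2 * a * b * (1 / 12 - |(t : ℝ) - s| * (1 - |(t : ℝ) - s|) / 2) := by
  have e : ∀ u, (a * sawtooth s u + b * sawtooth t u) ^ 2 = a ^ 2 * sawtooth s u ^ 2 +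
    2 * a * b * (sawtooth s u * sawtooth t u) + b ^ 2 * sawtooth t u ^ 2 := fun u => by ring
  have i1 : ∀ (a : ℝ) s, Integrable (fun u => a * sawtooth s u ^ 2) uniformLaw := fun a s =>
    (memLp_sawtooth s).integrable_sq.const_mul a
  have i2 : Integrable (fun u => 2 * a * b * (sawtooth s u * sawtooth t u)) uniformLaw :=
    ((memLp_sawtooth s).integrable_mul (memLp_sawtooth t)).const_mul _
  have i3 : Integrable (fun u => a ^ 2 * sawtooth s u ^ 2 +
    2 * a * b * (sawtooth s u * sawtooth t u)) uniformLaw := (i1 _ _).add i2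
  simp_rw [e]
  rw [integral_add i3 (i1 _ _), integral_add (i1 _ _) i2, integral_const_mul, integral_const_mul,
    integral_const_mul, integral_sawtooth_mul (abs_unitInterval_sub_le s t), integral_sawtooth_sq,
    integral_sawtooth_sq]
  ring

section Bridge

variable {Ω : Type*} [MeasurableSpace Ω] {μ : Measure Ω} {B : unitInterval → Ω → ℝ}

lemma IsBrownianBridge.aemeasurable (hB : IsBrownianBridge B μ) (s : unitInterval) :
    AEMeasurable (B s) μ := hB.isGaussianProcess.aemeasurable s

lemma integral_eq_zero_of_map_gaussianReal {X : Ω → ℝ} (hX : AEMeasurable X μ) {v : NNReal}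
    (h : μ.map X = gaussianReal 0 v) : ∫ ω, X ω ∂μ = 0 := by
  have := integral_map (f := fun x : ℝ => x) hX (by fun_prop)
  rw [← this, h, integral_id_gaussianReal]

lemma variance_of_map_gaussianReal {X : Ω → ℝ} (hX : AEMeasurable X μ) {v : NNReal}
    (h : μ.map X = gaussianReal 0 v) : Var[X; μ] = v := by
  have := variance_map (X := id) (Y := X) (μ := μ) (by fun_prop) hX
  rw [Function.id_comp] at this
  rw [← this, h, variance_id_gaussianReal]

lemma IsBrownianBridge.aemeasurable_pathMean (hB : IsBrownianBridge B μ) :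
    AEMeasurable (fun ω => pathMean fun s => B s ω) μ := by
  refine aemeasurable_of_tendsto_metrizable_ae atTop
    (f := fun (n : ℕ) ω => (n : ℝ)⁻¹ * ∑ k : Fin n, B (gridPoint n k) ω) (fun n => ?_) ?_
  · exact (Finset.aemeasurable_fun_sum _ fun k _ => hB.aemeasurable _).const_mul _
  · filter_upwards [hB.continuous_paths] with ω hω using tendsto_riemannSum_pathMean hω

lemma IsBrownianBridge.aemeasurable_centredProcess (hB : IsBrownianBridge B μ)
    (s : unitInterval) : AEMeasurable (centredProcess B s) μ :=
  (hB.aemeasurable s).sub hB.aemeasurable_pathMean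

variable [IsProbabilityMeasure μ]

lemma IsBrownianBridge.map_sum_mul (hB : IsBrownianBridge B μ) {ι : Type*} [Fintype ι]
    (s : ι → unitInterval) (a : ι → ℝ) : μ.map (fun ω => ∑ i, a i * B (s i) ω) =
      gaussianReal 0 (∫ u, (∑ i, a i * bridgeKernel (s i) u) ^ 2 ∂uniformLaw).toNNReal := by
  have hB2 : ∀ t, MemLp (B t) 2 μ := fun t =>
    (hB.isGaussianProcess.hasGaussianLaw_eval t).memLp_two
  have hg : HasGaussianLaw (fun ω => ∑ i, a i * B (s i) ω) μ :=
    ((hB.isGaussianProcess.comp_right s).smul a).hasGaussianLaw_fun_sum (I := Finset.univ)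
  rw [hg.map_eq_gaussianReal]
  have hmean : ∫ ω, ∑ i, a i * B (s i) ω ∂μ = 0 := by
    rw [integral_finsetSum _ fun i _ => ((hB2 (s i)).integrable one_le_two).const_mul _]
    exact Finset.sum_eq_zero fun i _ => by rw [integral_const_mul, hB.mean_eq_zero, mul_zero]
  have hvar : Var[fun ω => ∑ i, a i * B (s i) ω; μ] =
      ∫ u, (∑ i, a i * bridgeKernel (s i) u) ^ 2 ∂uniformLaw := by
    rw [variance_fun_sum fun i => (hB2 (s i)).const_mul _]
    have hprod : ∀ i j, Integrable (fun u => a i * bridgeKernel (s i) u *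
        (a j * bridgeKernel (s j) u)) uniformLaw := fun i j =>
      ((memLp_bridgeKernel (s i)).const_mul (a i)).integrable_mul
        ((memLp_bridgeKernel (s j)).const_mul (a j))
    simp_rw [sq, Finset.sum_mul_sum]
    rw [integral_finsetSum _ fun i _ => integrable_finsetSum _ fun j _ => hprod i j]
    refine Finset.sum_congr rfl fun i _ => ?_
    rw [integral_finsetSum _ fun j _ => hprod i j]
    refine Finset.sum_congr rfl fun j _ => ?_
    rw [covariance_const_mul_left, covariance_const_mul_right, hB.covariance_eq,
      ← integral_bridgeKernel_mul (s i).2 (s j).2, ← integral_const_mul, ← integral_const_mul]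
    congr 1
    ext u
    ring
  rw [hmean, hvar]

/-- The law of the linear functionals of a Brownian bridge and its mean. -/
theorem IsBrownianBridge.map_sum_mul_add_pathMean (hB : IsBrownianBridge B μ) {ι : Type*}
    [Fintype ι] (s : ι → unitInterval) (a : ι → ℝ) (c : ℝ) :
    μ.map (fun ω => ∑ i, a i * B (s i) ω + c * pathMean fun t => B t ω) =
      gaussianReal 0 (∫ u, (∑ i, a i * bridgeKernel (s i) u + c * centredId u) ^ 2
        ∂uniformLaw).toNNReal := by
  let X : ℕ → Ω → ℝ := fun n ω =>
    ∑ i, a i * B (s i) ω + c * ((n : ℝ)⁻¹ * ∑ k : Fin n, B (gridPoint n k) ω)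
  let g : ℕ → ℝ → ℝ := fun n u => ∑ i, a i * bridgeKernel (s i) u +
    c * ((n : ℝ)⁻¹ * ∑ k : Fin n, bridgeKernel (gridPoint n k) u)
  have hBm := hB.aemeasurable
  have hX : ∀ n, AEMeasurable (X n) μ := fun n =>
    (Finset.aemeasurable_fun_sum _ fun i _ => (hBm _).const_mul _).add
      (((Finset.aemeasurable_fun_sum _ fun k _ => hBm _).const_mul _).const_mul _)
  have hY : AEMeasurable (fun ω => ∑ i, a i * B (s i) ω + c * pathMean fun t => B t ω) μ :=
    (Finset.aemeasurable_fun_sum _ fun i _ => (hBm _).const_mul _).add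
      (hB.aemeasurable_pathMean.const_mul _)
  have hlaw : ∀ n, μ.map (X n) = gaussianReal 0 (∫ u, g n u ^ 2 ∂uniformLaw).toNNReal := by
    intro n
    -- The Riemann sum only adds finitely many evaluation points, so the approximant is an ordinary
    -- linear functional of the bridge.
    have h := hB.map_sum_mul (Sum.elim s (gridPoint n)) (Sum.elim a fun _ => c * (n : ℝ)⁻¹)
    simp only [Fintype.sum_sum_type, Sum.elim_inl, Sum.elim_inr, ← Finset.mul_sum, mul_assoc] at h
    exact h
  refine map_eq_gaussianReal_of_ae_tendsto hX hY hlaw ?_ ?_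
  · filter_upwards [hB.continuous_paths] with ω hω
    exact tendsto_const_nhds.add ((tendsto_riemannSum_pathMean hω).const_mul c)
  · refine (continuous_real_toNNReal.tendsto _).comp ?_
    refine tendsto_integral_of_dominated_convergence (fun _ => (∑ i, |a i| + |c|) ^ 2)
      (fun n => ?_) (integrable_const _) (fun n => ?_) ?_
    · refine (Measurable.pow_const ?_ 2).aestronglyMeasurable
      exact (Finset.measurable_fun_sum _ fun i _ => (measurable_bridgeKernel _).const_mul _).add
        (((Finset.measurable_fun_sum _ fun k _ => measurable_bridgeKernel _).const_mul _).const_mul _)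
    · filter_upwards [ae_uniformLaw_mem] with u hu
      rw [Real.norm_eq_abs, abs_pow]
      refine pow_le_pow_left₀ (abs_nonneg _) ?_ 2
      refine (abs_add_le _ _).trans (add_le_add ?_ ?_)
      · refine (Finset.abs_sum_le_sum_abs _ _).trans (Finset.sum_le_sum fun i _ => ?_)
        rw [abs_mul]
        exact mul_le_of_le_one_right (abs_nonneg _) (abs_bridgeKernel_le hu _)
      · rw [abs_mul]
        refine mul_le_of_le_one_right (abs_nonneg _) ?_
        rw [abs_mul, abs_inv, Nat.abs_cast]
        have hsum : |∑ k : Fin n, bridgeKernel (gridPoint n k) u| ≤ n := by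
          refine (Finset.abs_sum_le_sum_abs _ _).trans ?_
          refine (Finset.sum_le_sum fun k _ => abs_bridgeKernel_le hu _).trans_eq ?_
          simp
        rcases Nat.eq_zero_or_pos n with rfl | hn
        · simp
        · rw [inv_mul_le_one₀ (by exact_mod_cast hn)]
          exact hsum
    · filter_upwards [ae_uniformLaw_mem] with u hu
      exact (tendsto_const_nhds.add ((tendsto_riemannSum_bridgeKernel hu).const_mul c)).pow 2

/-! ### The centred process -/

/-- Subtracting the path mean removes `centredId` from every kernel and leaves the sawtooth, a
function of `s - u` alone; this is why the covariance is translation invariant. -/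
theorem IsBrownianBridge.map_sum_mul_centredProcess (hB : IsBrownianBridge B μ) {ι : Type*}
    [Fintype ι] (s : ι → unitInterval) (a : ι → ℝ) :
    μ.map (fun ω => ∑ i, a i * centredProcess B (s i) ω) =
      gaussianReal 0 (∫ u, (∑ i, a i * sawtooth (s i) u) ^ 2 ∂uniformLaw).toNNReal := by
  have h := hB.map_sum_mul_add_pathMean s a (-∑ i, a i)
  convert h using 4 with ω
  · simp only [centredProcess, mul_sub, Finset.sum_sub_distrib, Finset.sum_mul, neg_mul]
    ring
  · simp only [bridgeKernel, mul_add, Finset.sum_add_distrib, Finset.sum_mul, neg_mul]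
    ext u
    ring

theorem IsBrownianBridge.isGaussianProcess_centredProcess (hB : IsBrownianBridge B μ) :
    IsGaussianProcess (centredProcess B) μ := by
  classical
  refine ⟨fun I => ⟨isGaussian_of_map_eq_gaussianReal fun ℓ => ?_⟩⟩
  have hm : AEMeasurable (fun ω => I.restrict fun x => centredProcess B x ω) μ :=
    aemeasurable_pi_iff.2 fun i => hB.aemeasurable_centredProcess i
  rw [AEMeasurable.map_map_of_aemeasurable ℓ.continuous.aemeasurable hm]
  -- The coefficients are the values of the functional `ℓ` on the standard basis.
  have h := hB.map_sum_mul_centredProcess (fun i : I => (i : unitInterval))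
    fun i => ℓ fun j => if i = j then 1 else 0
  refine ⟨0, _, Eq.trans ?_ h⟩
  congr 1
  ext ω
  have e := LinearMap.pi_apply_eq_sum_univ (ℓ : (I → ℝ) →ₗ[ℝ] ℝ)
    (I.restrict fun x => centredProcess B x ω)
  simp only [ContinuousLinearMap.coe_coe, smul_eq_mul, Finset.restrict] at e
  rw [Function.comp_apply]
  refine e.trans (Finset.sum_congr rfl fun i _ => mul_comm _ _)

lemma IsBrownianBridge.map_centredProcess (hB : IsBrownianBridge B μ) (s : unitInterval) :
    μ.map (centredProcess B s) = gaussianReal 0 (1 / 12) := by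
  have h := hB.map_sum_mul_centredProcess (fun _ : Unit => s) fun _ => 1
  simp only [Finset.univ_unique, Finset.sum_singleton, one_mul, integral_sawtooth_sq] at h
  rw [show (fun ω => centredProcess B s ω) = centredProcess B s from rfl] at h
  rw [h]
  congr 1
  ext
  simp

theorem IsBrownianBridge.covariance_centredProcess (hB : IsBrownianBridge B μ)
    (s t : unitInterval) : cov[centredProcess B s, centredProcess B t; μ] =
      1 / 12 - |(t : ℝ) - s| * (1 - |(t : ℝ) - s|) / 2 := by
  have hm := hB.aemeasurable_centredProcess
  have hL : ∀ s, MemLp (centredProcess B s) 2 μ := fun s =>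
    (hB.isGaussianProcess_centredProcess.hasGaussianLaw_eval s).memLp_two
  have hadd := variance_add (hL s) (hL t)
  have hv : ∀ s, Var[centredProcess B s; μ] = 1 / 12 := fun s => by
    rw [variance_of_map_gaussianReal (hm s) (hB.map_centredProcess s)]; norm_num
  have h := hB.map_sum_mul_centredProcess ![s, t] ![1, 1]
  simp only [Fin.sum_univ_two, Matrix.cons_val_zero, Matrix.cons_val_one, one_mul] at h
  have hsum := integral_sawtooth_combo s t 1 1
  simp only [one_mul] at hsum
  have hvs := variance_of_map_gaussianReal ((hm s).add (hm t)) h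
  rw [Real.coe_toNNReal _ (integral_nonneg fun u => sq_nonneg _), hsum, hadd, hv, hv] at hvs
  linarith

/-! ### The optimal shift of a path -/

lemma shiftEnergy_eq {f : unitInterval → ℝ} (hf : Continuous f) (l : ℝ) :
    shiftEnergy f l = shiftEnergy f (pathMean f) + (l - pathMean f) ^ 2 := by
  have hint : ∀ {g : unitInterval → ℝ}, Continuous g → Integrable g := fun hg =>
    hg.integrable_of_hasCompactSupport (HasCompactSupport.of_compactSpace _)
  have expand : ∀ l, shiftEnergy f l = (∫ s, f s ^ 2) - 2 * l * pathMean f + l ^ 2 := by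
    intro l
    simp only [shiftEnergy, sq_abs]
    have e : ∀ s, (f s - l) ^ 2 = f s ^ 2 - 2 * l * f s + l ^ 2 := fun s => by ring
    have i1 : Integrable (fun s => f s ^ 2) := hint (by fun_prop)
    have i2 : Integrable (fun s => 2 * l * f s) := hint (by fun_prop)
    have i3 : Integrable (fun s => f s ^ 2 - 2 * l * f s) := i1.sub i2
    simp_rw [e]
    rw [integral_add i3 (integrable_const _), integral_sub i1 i2, integral_const_mul, pathMean]
    simp
  rw [expand, expand]
  ring

lemma forall_shiftEnergy_le_iff {f : unitInterval → ℝ} (hf : Continuous f) (l : ℝ) :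
    (∀ l', shiftEnergy f l ≤ shiftEnergy f l') ↔ l = pathMean f := by
  constructor
  · intro h
    have h1 := h (pathMean f)
    rw [shiftEnergy_eq hf l] at h1
    have : (l - pathMean f) ^ 2 = 0 := le_antisymm (by linarith) (sq_nonneg _)
    exact sub_eq_zero.1 (pow_eq_zero_iff two_ne_zero |>.1 this)
  · rintro rfl l'
    rw [shiftEnergy_eq hf l']
    linarith [sq_nonneg (l' - pathMean f)]

end Bridge


/-! ### The correlation of the signs of a Gaussian pair -/

lemma spin_neg (x : ℝ) : spin (-x) = -spin x := by simp [spin, neg_div]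

lemma spin_pos_mul {c : ℝ} (hc : 0 < c) (x : ℝ) : spin (c * x) = spin x := by
  rw [spin, spin, abs_mul, abs_of_pos hc, mul_div_mul_left _ _ hc.ne']

lemma spin_div_pos {c : ℝ} (hc : 0 < c) (x : ℝ) : spin (x / c) = spin x := by
  rw [div_eq_inv_mul, spin_pos_mul (inv_pos.2 hc)]

lemma spin_of_pos {x : ℝ} (hx : 0 < x) : spin x = 1 := by
  rw [spin, abs_of_pos hx, div_self hx.ne']

lemma spin_of_neg {x : ℝ} (hx : x < 0) : spin x = -1 := by
  rw [spin, abs_of_neg hx, div_neg, div_self hx.ne]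

lemma abs_spin_le (x : ℝ) : |spin x| ≤ 1 := by
  rw [spin, abs_div, abs_abs]
  exact div_self_le_one _

lemma measurable_spin : Measurable spin := by unfold spin; fun_prop

/-- The angular integrand of the correlation of the signs. -/
lemma intervalIntegral_spin_cos_mul (a : ℝ) :
    ∫ θ in -Real.pi..Real.pi, spin (Real.cos θ) * spin (a * Real.cos θ + Real.sin θ) =
      4 * Real.arctan a := by
  set h : ℝ → ℝ := fun θ => spin (Real.cos θ) * spin (a * Real.cos θ + Real.sin θ) with hdef
  -- Both signs flip under `θ ↦ θ + π`, so each half-turn can be moved to `(-π/2, π/2)`. There the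
  -- cosine is positive and the other factor changes sign once, at `-arctan a`.
  have hper : Function.Periodic h Real.pi := by
    intro θ
    simp only [hdef, Real.cos_add_pi, Real.sin_add_pi, spin_neg]
    rw [show a * -Real.cos θ + -Real.sin θ = -(a * Real.cos θ + Real.sin θ) by ring, spin_neg]
    ring
  have hmeas : Measurable h := by
    refine (measurable_spin.comp Real.measurable_cos).mul (measurable_spin.comp ?_)
    fun_prop
  have hbound : ∀ θ, ‖h θ‖ ≤ 1 := fun θ => by
    rw [Real.norm_eq_abs, hdef, abs_mul]
    exact mul_le_one₀ (abs_spin_le _) (abs_nonneg _) (abs_spin_le _)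
  have hint : ∀ x y : ℝ, IntervalIntegrable h volume x y := fun x y => by
    refine (intervalIntegrable_const (c := (1 : ℝ))).mono_fun hmeas.aestronglyMeasurable ?_
    exact ae_of_all _ fun θ => by simpa using hbound θ
  have e1 : ∫ θ in -Real.pi..0, h θ = ∫ θ in -(Real.pi / 2)..(Real.pi / 2), h θ := by
    have := hper.intervalIntegral_add_eq (-Real.pi) (-(Real.pi / 2))
    rw [neg_add_cancel] at this
    rw [this]
    congr 1; ring
  have e2 : ∫ θ in (0 : ℝ)..Real.pi, h θ = ∫ θ in -(Real.pi / 2)..(Real.pi / 2), h θ := by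
    have := hper.intervalIntegral_add_eq 0 (-(Real.pi / 2))
    rw [zero_add] at this
    rw [this]
    congr 1; ring
  have ha1 := Real.neg_pi_div_two_lt_arctan a
  have ha2 := Real.arctan_lt_pi_div_two a
  have hcos : 0 < Real.cos (Real.arctan a) := Real.cos_arctan_pos a
  have hsum : ∀ θ, a * Real.cos θ + Real.sin θ =
      Real.sin (θ + Real.arctan a) / Real.cos (Real.arctan a) := by
    intro θ
    have ht : Real.sin (Real.arctan a) = a * Real.cos (Real.arctan a) := by
      rw [← Real.tan_mul_cos hcos.ne', Real.tan_arctan]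
    rw [Real.sin_add, ht, eq_div_iff hcos.ne']
    ring
  have e3 : ∫ θ in -(Real.pi / 2)..(-Real.arctan a), h θ =
      ∫ _ in -(Real.pi / 2)..(-Real.arctan a), (-1 : ℝ) := by
    rw [intervalIntegral.integral_of_le (by linarith), intervalIntegral.integral_of_le (by linarith),
      integral_Ioc_eq_integral_Ioo, integral_Ioc_eq_integral_Ioo]
    refine setIntegral_congr_fun measurableSet_Ioo fun θ hθ => ?_
    simp only [hdef]
    rw [hsum, spin_div_pos hcos,
      spin_of_pos (Real.cos_pos_of_mem_Ioo ⟨hθ.1, by linarith [hθ.2]⟩),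
      spin_of_neg (Real.sin_neg_of_neg_of_neg_pi_lt (by linarith [hθ.2]) (by linarith [hθ.1])), one_mul]
  have e4 : ∫ θ in (-Real.arctan a)..(Real.pi / 2), h θ =
      ∫ _ in (-Real.arctan a)..(Real.pi / 2), (1 : ℝ) := by
    rw [intervalIntegral.integral_of_le (by linarith), intervalIntegral.integral_of_le (by linarith),
      integral_Ioc_eq_integral_Ioo, integral_Ioc_eq_integral_Ioo]
    refine setIntegral_congr_fun measurableSet_Ioo fun θ hθ => ?_
    simp only [hdef]
    rw [hsum, spin_div_pos hcos,
      spin_of_pos (Real.cos_pos_of_mem_Ioo ⟨by linarith [hθ.1], hθ.2⟩),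
      spin_of_pos (Real.sin_pos_of_pos_of_lt_pi (by linarith [hθ.1]) (by linarith [hθ.2])), one_mul]
  rw [← intervalIntegral.integral_add_adjacent_intervals (hint _ 0) (hint 0 _), e1, e2,
    ← intervalIntegral.integral_add_adjacent_intervals (hint _ (-Real.arctan a)) (hint _ _), e3, e4]
  simp
  ring

lemma integral_mul_exp_neg_sq_div_two :
    ∫ r in Set.Ioi (0 : ℝ), r * Real.exp (-(r ^ 2 / 2)) = 1 := by
  have h := integral_mul_cexp_neg_mul_sq (b := 1 / 2) (by norm_num)
  have e : ∀ r : ℝ, (r : ℂ) * Complex.exp (-(1 / 2) * (r : ℂ) ^ 2) =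
      ((r * Real.exp (-(r ^ 2 / 2)) : ℝ) : ℂ) := by
    intro r
    push_cast
    congr 2
    ring
  simp_rw [e] at h
  rw [integral_complex_ofReal] at h
  have h2 : ((∫ r in Set.Ioi (0 : ℝ), r * Real.exp (-(r ^ 2 / 2)) : ℝ) : ℂ) = ((1 : ℝ) : ℂ) := by
    rw [h]; norm_num
  exact_mod_cast h2

/-- The law of two independent standard Gaussian variables. -/
def stdPair : Measure (ℝ × ℝ) := (gaussianReal 0 1).prod (gaussianReal 0 1)

instance isProbabilityMeasure_stdPair : IsProbabilityMeasure stdPair := by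
  unfold stdPair; infer_instance

theorem integral_spin_mul_spin_stdPair (a : ℝ) :
    ∫ z, spin z.1 * spin (a * z.1 + z.2) ∂stdPair = 2 / Real.pi * Real.arctan a := by
  have hg : Measurable fun z : ℝ × ℝ => gaussianPDF 0 1 z.1 * gaussianPDF 0 1 z.2 := by fun_prop
  rw [stdPair, gaussianReal_of_var_ne_zero _ one_ne_zero,
    prod_withDensity (measurable_gaussianPDF _ _) (measurable_gaussianPDF _ _),
    integral_withDensity_eq_integral_toReal_smul hg
      (ae_of_all _ fun z => ENNReal.mul_lt_top gaussianPDF_lt_top gaussianPDF_lt_top),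
    ← Measure.volume_eq_prod, ← integral_comp_polarCoord_symm, polarCoord_target]
  -- Signs ignore the radius and the density ignores the angle, so the integrand factorizes in polar
  -- coordinates.
  have hpt : ∀ p ∈ Set.Ioi (0 : ℝ) ×ˢ Set.Ioo (-Real.pi) Real.pi,
      p.1 • ((gaussianPDF 0 1 (polarCoord.symm p).1 * gaussianPDF 0 1 (polarCoord.symm p).2).toReal •
        (spin (polarCoord.symm p).1 * spin (a * (polarCoord.symm p).1 + (polarCoord.symm p).2))) =
      (p.1 * Real.exp (-(p.1 ^ 2 / 2))) * ((2 * Real.pi)⁻¹ *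
        (spin (Real.cos p.2) * spin (a * Real.cos p.2 + Real.sin p.2))) := by
    rintro ⟨r, θ⟩ ⟨hr, -⟩
    simp only [Set.mem_Ioi] at hr
    simp only [polarCoord_symm_apply, ENNReal.toReal_mul, toReal_gaussianPDF, smul_eq_mul]
    rw [show a * (r * Real.cos θ) + r * Real.sin θ = r * (a * Real.cos θ + Real.sin θ) by ring,
      spin_pos_mul hr, spin_pos_mul hr]
    have hpdf : gaussianPDFReal 0 1 (r * Real.cos θ) * gaussianPDFReal 0 1 (r * Real.sin θ) =
        (2 * Real.pi)⁻¹ * Real.exp (-(r ^ 2 / 2)) := by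
      rw [gaussianPDFReal, gaussianPDFReal]
      have e1 : (√(2 * Real.pi * ((1 : NNReal) : ℝ)))⁻¹ * (√(2 * Real.pi * ((1 : NNReal) : ℝ)))⁻¹ =
          (2 * Real.pi)⁻¹ := by
        rw [← mul_inv, Real.mul_self_sqrt (by positivity)]
        simp
      rw [mul_mul_mul_comm, e1, ← Real.exp_add]
      congr 2
      have := Real.sin_sq_add_cos_sq θ
      push_cast
      field_simp
      linear_combination (-r ^ 2) * this
    rw [hpdf]
    ring
  rw [setIntegral_congr_fun (measurableSet_Ioi.prod measurableSet_Ioo) hpt, Measure.volume_eq_prod,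
    setIntegral_prod_mul (fun r => r * Real.exp (-(r ^ 2 / 2)))
      (fun θ => (2 * Real.pi)⁻¹ * (spin (Real.cos θ) * spin (a * Real.cos θ + Real.sin θ))),
    integral_mul_exp_neg_sq_div_two, integral_const_mul, ← integral_Ioc_eq_integral_Ioo,
    ← intervalIntegral.integral_of_le (by linarith [Real.pi_pos]), intervalIntegral_spin_cos_mul]
  field_simp
  ring

/-! ### The limit of the pair of displacements -/

/-- A centred Gaussian pair of variance `1/12` and correlation `1 - 6 τ (1 - τ)`. -/
def gaussianPair (τ : ℝ) (z : ℝ × ℝ) : Fin 2 → ℝ :=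
  ![z.1 / √12, ((1 - 6 * τ * (1 - τ)) * z.1 +
    √(12 * τ * (1 - τ) * (1 - 3 * τ * (1 - τ))) * z.2) / √12]

lemma measurable_gaussianPair (τ : ℝ) : Measurable (gaussianPair τ) := by
  refine measurable_pi_lambda _ fun i => ?_
  fin_cases i <;> simp only [gaussianPair] <;> simp <;> fun_prop

lemma map_linear_stdPair (α β : ℝ) :
    stdPair.map (fun z => α * z.1 + β * z.2) = gaussianReal 0 (α ^ 2 + β ^ 2).toNNReal := by
  have h := gaussianReal_add_gaussianReal_of_indepFun (P := stdPair)
    (X := fun z => α * z.1) (Y := fun z => β * z.2)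
    (m₁ := 0) (m₂ := 0) (v₁ := (α ^ 2).toNNReal) (v₂ := (β ^ 2).toNNReal)
    (indepFun_prod (X := fun x : ℝ => α * x) (Y := fun x : ℝ => β * x)
      (by fun_prop) (by fun_prop)) ?_ ?_
  · rw [add_zero, ← Real.toNNReal_add (sq_nonneg _) (sq_nonneg _)] at h
    exact h
  · have : (fun z : ℝ × ℝ => α * z.1) = (fun x => α * x) ∘ Prod.fst := rfl
    rw [this, ← Measure.map_map (by fun_prop) measurable_fst, stdPair, Measure.map_fst_prod,
      measure_univ, one_smul, gaussianReal_map_const_mul, mul_zero]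
    congr 1
    ext
    simp [sq_nonneg]
  · have : (fun z : ℝ × ℝ => β * z.2) = (fun x => β * x) ∘ Prod.snd := rfl
    rw [this, ← Measure.map_map (by fun_prop) measurable_snd, stdPair, Measure.map_snd_prod,
      measure_univ, one_smul, gaussianReal_map_const_mul, mul_zero]
    congr 1
    ext
    simp [sq_nonneg]

lemma mul_one_sub_nonneg {τ : ℝ} (h0 : 0 ≤ τ) (h1 : τ ≤ 1) :
    0 ≤ 12 * τ * (1 - τ) * (1 - 3 * τ * (1 - τ)) := by
  have h2 : 0 ≤ 1 - 3 * τ * (1 - τ) := by nlinarith [sq_nonneg (2 * τ - 1)]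
  have h3 : 0 ≤ 1 - τ := by linarith
  positivity

/-- With `ρ = 1 - 6 τ (1 - τ)`, the coefficient of the second variable is `√(1 - ρ^2)`, because `1 -
ρ^2 = 12 τ (1 - τ) (1 - 3 τ (1 - τ))`. The pair thus has the variances of the sawtooth combinations.
-/
lemma map_sum_mul_gaussianPair (s t : unitInterval) (θ : Fin 2 → ℝ) :
    stdPair.map (fun z => ∑ i, θ i * gaussianPair |(t : ℝ) - s| z i) =
      gaussianReal 0 (∫ u, (∑ i, θ i * sawtooth (![(s : ℝ), (t : ℝ)] i) u) ^ 2
        ∂uniformLaw).toNNReal := by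
  set τ := |(t : ℝ) - s| with hτ
  set ρ := 1 - 6 * τ * (1 - τ) with hρ
  have hc := Real.sq_sqrt (mul_one_sub_nonneg (abs_nonneg ((t : ℝ) - s))
    (abs_unitInterval_sub_le s t))
  rw [← hτ] at hc
  set c := √(12 * τ * (1 - τ) * (1 - 3 * τ * (1 - τ))) with hcdef
  have h12 : √(12 : ℝ) ≠ 0 := by positivity
  have h12' : √(12 : ℝ) ^ 2 = 12 := Real.sq_sqrt (by norm_num)
  have e : (fun z => ∑ i, θ i * gaussianPair τ z i) = fun z : ℝ × ℝ =>
      (θ 0 + ρ * θ 1) / √12 * z.1 + c * θ 1 / √12 * z.2 := by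
    ext z
    simp only [Fin.sum_univ_two, gaussianPair, Matrix.cons_val_zero, Matrix.cons_val_one]
    rw [← hρ, ← hcdef]
    field_simp
    ring
  rw [e, map_linear_stdPair]
  simp only [Fin.sum_univ_two, Matrix.cons_val_zero, Matrix.cons_val_one]
  rw [integral_sawtooth_combo, ← hτ]
  congr 2
  rw [div_pow, div_pow, h12', mul_pow, hc, hρ]
  ring

lemma integral_spin_gaussianPair {τ : ℝ} (hτ : τ ∈ Set.Ioo (0 : ℝ) 1) :
    ∫ z, spin (gaussianPair τ z 0) * spin (gaussianPair τ z 1) ∂stdPair = Gpbc τ := by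
  have hpos : 0 < 12 * τ * (1 - τ) * (1 - 3 * τ * (1 - τ)) := by
    have h2 : 0 < 1 - 3 * τ * (1 - τ) := by nlinarith [sq_nonneg (2 * τ - 1)]
    have h3 : 0 < 1 - τ := by linarith [hτ.2]
    have := hτ.1
    positivity
  have hc := Real.sqrt_pos.2 hpos
  have h12 : 0 < √(12 : ℝ) := by positivity
  rw [Gpbc, ← integral_spin_mul_spin_stdPair]
  congr 1
  ext z
  simp only [gaussianPair, Matrix.cons_val_zero, Matrix.cons_val_one]
  rw [spin_div_pos h12, spin_div_pos h12]
  congr 1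
  rw [← spin_pos_mul hc (_ + z.2), mul_add, ← mul_assoc, mul_div_cancel₀ _ hc.ne']

/-- The sums of two sawtooth functions over the points converge to a Gaussian pair. -/
lemma tendstoInDistribution_sawtooth_pair {Ω : Type*} {mΩ : MeasurableSpace Ω} {μ : Measure Ω}
    [IsProbabilityMeasure μ] (s t : unitInterval) {Z : Ω → Fin 2 → ℝ} (hZm : AEMeasurable Z μ)
    (hZ : ∀ θ : Fin 2 → ℝ, μ.map (fun ω => ∑ i, θ i * Z ω i) =
      gaussianReal 0 (∫ u, (∑ i, θ i * sawtooth (![(s : ℝ), (t : ℝ)] i) u) ^ 2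
        ∂uniformLaw).toNNReal) :
    TendstoInDistribution (fun (L : ℕ) u (i : Fin 2) =>
      (√(L : ℝ))⁻¹ * pointSum L (sawtooth (![(s : ℝ), (t : ℝ)] i)) u) atTop Z
      (fun _ => uniformSeq) μ :=
  tendstoInDistribution_pointSum (fun _ => measurable_sawtooth _) (fun _ => memLp_sawtooth _)
    (fun _ => integral_sawtooth _) hZm hZ

/-- The product of the spins of a pair of displacements. -/
def spinProduct (v : Fin 2 → ℝ) : ℝ := spin (v 0) * spin (v 1)

lemma measurable_spinProduct : Measurable spinProduct :=
  (measurable_spin.comp (measurable_pi_apply 0)).mul (measurable_spin.comp (measurable_pi_apply 1))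

/-- The pair of values of the centred process and the explicit Gaussian pair are weak limits of the
same normalized sums, hence have the same law; the integral is then the polar-coordinate one. -/
theorem IsBrownianBridge.integral_spin_centredProcess {Ω : Type*} [MeasurableSpace Ω]
    {μ : Measure Ω} [IsProbabilityMeasure μ] {B : unitInterval → Ω → ℝ}
    (hB : IsBrownianBridge B μ) {s t : unitInterval} (h0 : 0 < |(t : ℝ) - s|)
    (h1 : |(t : ℝ) - s| < 1) :
    ∫ ω, spin (centredProcess B s ω) * spin (centredProcess B t ω) ∂μ = Gpbc |(t : ℝ) - s| := by
  have hm : AEMeasurable (fun ω i => centredProcess B (![s, t] i) ω) μ :=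
    aemeasurable_pi_iff.2 fun i => hB.aemeasurable_centredProcess _
  have hlaw := tendstoInDistribution_unique _
    (tendstoInDistribution_sawtooth_pair s t hm fun θ => by
      rw [hB.map_sum_mul_centredProcess ![s, t] θ]
      congr 3)
    (tendstoInDistribution_sawtooth_pair s t (measurable_gaussianPair _).aemeasurable
      (map_sum_mul_gaussianPair s t))
  have e1 := integral_map (f := spinProduct) hm measurable_spinProduct.aestronglyMeasurable
  have e2 := integral_map (f := spinProduct) (μ := stdPair)
    (measurable_gaussianPair |(t : ℝ) - s|).aemeasurable measurable_spinProduct.aestronglyMeasurable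
  rw [hlaw, e2] at e1
  have e3 := integral_spin_gaussianPair (τ := |(t : ℝ) - s|) ⟨h0, h1⟩
  unfold spinProduct at e1
  rw [e3] at e1
  simpa using e1.symm

/-! ### The zeros of the limiting two-point function -/

theorem Gpbc_eq_zero_iff {τ : ℝ} (hτ : τ ∈ Set.Ioo (0 : ℝ) 1) :
    Gpbc τ = 0 ↔ τ = (3 - √3) / 6 ∨ τ = 1 - (3 - √3) / 6 := by
  have hpos : 0 < 12 * τ * (1 - τ) * (1 - 3 * τ * (1 - τ)) := by
    have h2 : 0 < 1 - 3 * τ * (1 - τ) := by nlinarith [sq_nonneg (2 * τ - 1)]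
    have h3 : 0 < 1 - τ := by linarith [hτ.2]
    have := hτ.1
    positivity
  have h3 : √(3 : ℝ) ^ 2 = 3 := Real.sq_sqrt (by norm_num)
  have hfac : 1 - 6 * τ * (1 - τ) = 6 * ((τ - (3 - √3) / 6) * (τ - (1 - (3 - √3) / 6))) := by
    linear_combination ((1 : ℝ) / 6) * h3
  rw [Gpbc, mul_eq_zero, or_iff_right (div_ne_zero two_ne_zero Real.pi_ne_zero),
    Real.arctan_eq_zero_iff, div_eq_zero_iff, or_iff_left (Real.sqrt_pos.2 hpos).ne', hfac,
    mul_eq_zero, or_iff_right (by norm_num : (6 : ℝ) ≠ 0), mul_eq_zero, sub_eq_zero, sub_eq_zero]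


/-! ### Joint convergence of the displacements -/

/-- Weak convergence sees only the laws, so it may be proved on the common space of the coupling,
where errors can be compared in probability. -/
lemma tendstoInDistribution_of_scalePoints {E Ω : Type*} [TopologicalSpace E] [MeasurableSpace E]
    [OpensMeasurableSpace E] {mΩ : MeasurableSpace Ω} {μ : Measure Ω} [IsProbabilityMeasure μ]
    {X : (L : ℕ) → (Fin L → ℝ) → E} {Z : Ω → E} (hX : ∀ L, AEMeasurable (X L) (blueLaw L))
    (h : TendstoInDistribution (fun L u => X L (scalePoints L u)) atTop Z (fun _ => uniformSeq) μ) :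
    TendstoInDistribution X atTop Z blueLaw μ := by
  refine ⟨hX, h.aemeasurable_limit, h.tendsto.congr fun L => ?_⟩
  refine Subtype.ext ?_
  have h1 := hX L
  rw [← map_scalePoints_uniformSeq] at h1
  have h2 := AEMeasurable.map_map_of_aemeasurable h1 (measurable_scalePoints L).aemeasurable
  rw [map_scalePoints_uniformSeq] at h2
  exact h2.symm

lemma aemeasurable_comp_scalePoints {L : ℕ} {f : (Fin L → ℝ) → ℝ}
    (hf : AEMeasurable f (blueLaw L)) : AEMeasurable (fun u => f (scalePoints L u)) uniformSeq := by
  rw [← map_scalePoints_uniformSeq] at hf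
  exact hf.comp_measurable (measurable_scalePoints L)

lemma abs_floor_div_sub_le {L : ℕ} (hL : 0 < L) (s : unitInterval) :
    |((min ⌊(s : ℝ) * L⌋₊ (L - 1) : ℕ) : ℝ) / L - s| ≤ 1 / L := by
  have hL' : (0 : ℝ) < L := by exact_mod_cast hL
  have hs0 : 0 ≤ (s : ℝ) * L := mul_nonneg s.2.1 hL'.le
  have hs1 : (s : ℝ) * L ≤ L := mul_le_of_le_one_left hL'.le s.2.2
  have h1 := Nat.floor_le hs0
  have h2 := Nat.lt_floor_add_one ((s : ℝ) * L)
  have h3 : ((L - 1 : ℕ) : ℝ) = L - 1 := by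
    rw [Nat.cast_sub hL]; simp
  rw [div_sub' hL'.ne', abs_div, abs_of_pos hL', div_le_div_iff_of_pos_right hL', abs_le, Nat.cast_min,
    h3]
  constructor
  · have : (s : ℝ) * L - 1 ≤ min (⌊(s : ℝ) * L⌋₊ : ℝ) (L - 1) := le_min (by linarith) (by linarith)
    linarith
  · have := min_le_left (⌊(s : ℝ) * L⌋₊ : ℝ) (L - 1)
    linarith

lemma eventually_measureReal_exists_not_displacementApprox {ι : Type*} [Fintype ι]
    (s : ι → unitInterval) {ε δ : ℝ} (hε : 0 < ε) (hδ : 0 < δ) :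
    ∀ᶠ L : ℕ in atTop, ∀ x : ι → Fin L, (∀ m, |((x m : ℕ) : ℝ) / L - s m| ≤ 1 / L) →
      uniformSeq.real {u | ∃ m, ¬ DisplacementApprox L u (x m) (s m) (ε * √L)} ≤ δ := by
  -- Adding one keeps the divisor of `δ` positive when there are no indices.
  have hcard : 0 < (Fintype.card ι : ℝ) + 1 := by positivity
  obtain ⟨η, hη, h⟩ := exists_displacementApprox hε (div_pos hδ hcard)
  have hinv : Tendsto (fun L : ℕ => 1 / (L : ℝ)) atTop (𝓝 0) := tendsto_one_div_atTop_nhds_zero_nat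
  filter_upwards [h, hinv.eventually_le_const hη] with L h1 h2 x hx
  rw [Set.ofPred_exists]
  refine (measureReal_iUnion_fintype_le _).trans ?_
  refine (Finset.sum_le_sum fun m _ => h1 (x m) (s m) ((hx m).trans h2)).trans ?_
  rw [Finset.sum_const, Finset.card_univ, nsmul_eq_mul, mul_div_assoc', div_le_iff₀ hcard]
  linarith [mul_comm δ (Fintype.card ι : ℝ)]

theorem IsBrownianBridge.tendstoInDistribution {Ω : Type*} [MeasurableSpace Ω] {μ : Measure Ω}
    [IsProbabilityMeasure μ] {B : unitInterval → Ω → ℝ} (hB : IsBrownianBridge B μ) (k : ℕ)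
    (s : Fin k → unitInterval) :
    TendstoInDistribution
      (fun (L : ℕ) (b : Fin L → ℝ) =>
        ((fun m : Fin k => rescale L (orderedDisplacement L b) (s m)),
          scaledShift L b,
          (fun m : Fin k => rescale L (displacement L b) (s m))))
      atTop
      (fun ω => ((fun m : Fin k => B (s m) ω),
        (pathMean fun u => B u ω),
        (fun m : Fin k => centredProcess B (s m) ω)))
      blueLaw μ := by
  have hm1 : ∀ L m, AEMeasurable (fun b => rescale L (orderedDisplacement L b) (s m)) (blueLaw L) :=
    fun L m => aemeasurable_rescale L (aemeasurable_orderedDisplacement L) (s m)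
  have hm2 : ∀ L m, AEMeasurable (fun b => rescale L (displacement L b) (s m)) (blueLaw L) :=
    fun L m => aemeasurable_rescale L (aemeasurable_displacement L) (s m)
  refine tendstoInDistribution_of_scalePoints (fun L => (aemeasurable_pi_lambda _ (hm1 L)).prodMk
    ((aemeasurable_scaledShift L).prodMk (aemeasurable_pi_lambda _ (hm2 L)))) ?_
  -- The index `none` carries the path mean. The displacements are not separate coordinates of the
  -- limit theorem: the continuous map `T` recovers them by subtraction.
  let Z : Ω → Option (Fin k) → ℝ := fun ω m => m.elim (pathMean fun u => B u ω) fun m => B (s m) ω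
  let h : Option (Fin k) → ℝ → ℝ := fun m => m.elim centredId fun m => bridgeKernel (s m)
  let T : (Option (Fin k) → ℝ) → (Fin k → ℝ) × ℝ × (Fin k → ℝ) := fun v =>
    (fun m => v (some m), v none, fun m => v (some m) - v none)
  have hT : Continuous T := by fun_prop
  have hclt : TendstoInDistribution (fun (L : ℕ) u i => (√(L : ℝ))⁻¹ * pointSum L (h i) u) atTop Z
      (fun _ => uniformSeq) μ := by
    refine tendstoInDistribution_pointSum (fun i => ?_) (fun i => ?_) (fun i => ?_)
      (aemeasurable_pi_iff.2 fun i => ?_) fun θ => ?_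
    · cases i; exacts [measurable_centredId, measurable_bridgeKernel _]
    · cases i; exacts [memLp_centredId, memLp_bridgeKernel _]
    · cases i; exacts [integral_centredId, integral_bridgeKernel _]
    · cases i; exacts [hB.aemeasurable_pathMean, hB.aemeasurable _]
    · have := hB.map_sum_mul_add_pathMean s (fun m => θ (some m)) (θ none)
      simp only [Fintype.sum_option, Z, h, Option.elim_none, Option.elim_some]
      simpa only [add_comm] using this
  refine tendstoInDistribution_of_tendstoInMeasure_sub _ _ (hclt.continuous_comp hT) ?_ fun L =>
    (aemeasurable_pi_lambda _ fun m => aemeasurable_comp_scalePoints (hm1 L m)).prodMk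
      ((aemeasurable_comp_scalePoints (aemeasurable_scaledShift L)).prodMk
        (aemeasurable_pi_lambda _ fun m => aemeasurable_comp_scalePoints (hm2 L m)))
  refine tendstoInMeasure_of_real fun ε hε δ hδ => ?_
  -- The position `0` attached to `none` is arbitrary: it only gives access to the estimate of the
  -- shift, even when `k = 0`.
  filter_upwards [eventually_measureReal_exists_not_displacementApprox
    (fun m : Option (Fin k) => m.elim 0 s) (half_pos hε) hδ, eventually_gt_atTop 0] with L h1 hL
  have h2 := h1 (fun m => ⟨min ⌊((m.elim 0 s : unitInterval) : ℝ) * L⌋₊ (L - 1), by omega⟩)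
    fun m => abs_floor_div_sub_le hL _
  refine (measureReal_mono ?_ (measure_ne_top _ _)).trans h2
  intro u hu
  simp only [Set.mem_ofPred_eq] at hu ⊢
  by_contra hcon
  push Not at hcon
  refine absurd hu (not_le.2 (lt_of_le_of_lt ?_ (half_lt_self hε)))
  have hR : 0 < √(L : ℝ) := Real.sqrt_pos.2 (by exact_mod_cast hL)
  have hscale : ∀ x y : ℝ, |x - y| ≤ ε / 2 * √L → ‖x / √L - (√(L : ℝ))⁻¹ * y‖ ≤ ε / 2 := by
    intro x y hxy
    rw [inv_mul_eq_div, ← sub_div, Real.norm_eq_abs, abs_div, abs_of_pos hR, div_le_iff₀ hR]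
    exact hxy
  have hε2 : 0 ≤ ε / 2 := (half_pos hε).le
  refine norm_prod_le_iff.2 ⟨(pi_norm_le_iff_of_nonneg hε2).2 fun m => ?_, norm_prod_le_iff.2
    ⟨?_, (pi_norm_le_iff_of_nonneg hε2).2 fun m => ?_⟩⟩
  · have := (hcon (some m)).ordered
    simp only [Pi.sub_apply, Prod.fst_sub, Function.comp_apply, T, h, rescale, dif_pos hL,
      Option.elim_some] at this ⊢
    exact hscale _ _ this
  · have := (hcon none).shift
    simp only [Pi.sub_apply, Prod.fst_sub, Prod.snd_sub, Function.comp_apply, T, h, scaledShift,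
      Option.elim_none] at this ⊢
    exact hscale _ _ this
  · have := (hcon (some m)).displacement
    simp only [Pi.sub_apply, Prod.snd_sub, Function.comp_apply, T, h, rescale, dif_pos hL,
      Option.elim_some, Option.elim_none] at this ⊢
    rw [← mul_sub, ← pointSum_sawtooth]
    exact hscale _ _ this

/-! ### Convergence of the two-point function -/

lemma spinProduct_eq_indicator (v : Fin 2 → ℝ) : spinProduct v =
    {v : Fin 2 → ℝ | 0 < v 0 * v 1}.indicator 1 v - {v : Fin 2 → ℝ | v 0 * v 1 < 0}.indicator 1 v := by
  have h : spinProduct v = spin (v 0 * v 1) := by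
    rw [spinProduct, spin, spin, spin, abs_mul, div_mul_div_comm]
  rw [h]
  rcases lt_trichotomy (v 0 * v 1) 0 with h0 | h0 | h0
  · simp [Set.indicator, spin_of_neg h0, h0, not_lt.2 h0.le]
  · simp [Set.indicator, h0, spin]
  · simp [Set.indicator, spin_of_pos h0, h0, not_lt.2 h0.le]

lemma integral_spinProduct (ν : Measure (Fin 2 → ℝ)) [IsProbabilityMeasure ν] :
    ∫ v, spinProduct v ∂ν =
      ν.real {v | 0 < v 0 * v 1} - ν.real {v | v 0 * v 1 < 0} := by
  have m1 : MeasurableSet {v : Fin 2 → ℝ | 0 < v 0 * v 1} :=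
    measurableSet_lt (by fun_prop) (by fun_prop)
  have m2 : MeasurableSet {v : Fin 2 → ℝ | v 0 * v 1 < 0} :=
    measurableSet_lt (by fun_prop) (by fun_prop)
  simp_rw [spinProduct_eq_indicator]
  rw [integral_sub ((integrable_const 1).indicator m1) ((integrable_const 1).indicator m2),
    integral_indicator_one m1, integral_indicator_one m2]

/-- The product of signs is a difference of indicators of two open sets whose frontiers lie in the
coordinate axes, so the portmanteau theorem applies despite the discontinuity. -/
lemma tendsto_integral_spinProduct {Ω Ω' : Type*} {mΩ : MeasurableSpace Ω}
    {mΩ' : MeasurableSpace Ω'} {P : Measure Ω} [IsProbabilityMeasure P] {μ : Measure Ω'}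
    [IsProbabilityMeasure μ] {X : ℕ → Ω → Fin 2 → ℝ} {Z : Ω' → Fin 2 → ℝ}
    (h : TendstoInDistribution X atTop Z (fun _ => P) μ)
    (hZ : (μ.map Z) {v | v 0 * v 1 = 0} = 0) :
    Tendsto (fun n => ∫ ω, spinProduct (X n ω) ∂P) atTop (𝓝 (∫ ω, spinProduct (Z ω) ∂μ)) := by
  have e : ∀ {Ω : Type _} {mΩ : MeasurableSpace Ω} {P : Measure Ω} [IsProbabilityMeasure P]
      {X : Ω → Fin 2 → ℝ}, AEMeasurable X P → ∫ ω, spinProduct (X ω) ∂P =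
      (P.map X).real {v | 0 < v 0 * v 1} - (P.map X).real {v | v 0 * v 1 < 0} := by
    intro Ω mΩ P _ X hX
    have := Measure.isProbabilityMeasure_map hX
    rw [← integral_spinProduct, integral_map hX measurable_spinProduct.aestronglyMeasurable]
  have e' : ∀ n, ∫ ω, spinProduct (X n ω) ∂P =
      (P.map (X n)).real {v | 0 < v 0 * v 1} - (P.map (X n)).real {v | v 0 * v 1 < 0} := fun n => by
    have := Measure.isProbabilityMeasure_map (h.forall_aemeasurable n)
    rw [← integral_spinProduct, integral_map (h.forall_aemeasurable n)
      measurable_spinProduct.aestronglyMeasurable]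
  simp_rw [e']
  rw [e h.aemeasurable_limit]
  have hconv : ∀ A : Set (Fin 2 → ℝ), frontier A ⊆ {v | v 0 * v 1 = 0} →
      Tendsto (fun n => (P.map (X n)).real A) atTop (𝓝 ((μ.map Z).real A)) := by
    intro A hA
    have := ProbabilityMeasure.tendsto_measure_of_null_frontier_of_tendsto' h.tendsto (E := A)
      (measure_mono_null hA hZ)
    exact (ENNReal.tendsto_toReal (measure_ne_top _ _)).comp this
  refine (hconv _ ?_).sub (hconv _ ?_)
  · refine (frontier_lt_subset_eq (by fun_prop) (by fun_prop)).trans fun v hv => ?_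
    exact hv.symm
  · exact frontier_lt_subset_eq (by fun_prop) (by fun_prop)

/-- Each coordinate is Gaussian with positive variance `1/12`, so it has no atom at zero; no
nondegeneracy of the pair is needed. -/
lemma map_gaussianPair_null (s t : unitInterval) :
    (stdPair.map (gaussianPair |(t : ℝ) - s|)) {v | v 0 * v 1 = 0} = 0 := by
  have hm := measurable_gaussianPair |(t : ℝ) - s|
  have hcoord : ∀ i : Fin 2, stdPair {z | gaussianPair |(t : ℝ) - s| z i = 0} = 0 := by
    intro i
    have h := map_sum_mul_gaussianPair s t (Pi.single i 1)
    have e1 : (fun z => ∑ j, Pi.single (M := fun _ : Fin 2 => ℝ) i (1 : ℝ) j *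
        gaussianPair |(t : ℝ) - s| z j) = fun z => gaussianPair |(t : ℝ) - s| z i := by
      ext z
      simp [Pi.single_apply]
    have e2 : ∀ u, ∑ j, Pi.single (M := fun _ : Fin 2 => ℝ) i (1 : ℝ) j *
        sawtooth (![(s : ℝ), (t : ℝ)] j) u = sawtooth (![(s : ℝ), (t : ℝ)] i) u := by
      intro u
      simp [Pi.single_apply]
    simp_rw [e2] at h
    rw [e1, integral_sawtooth_sq] at h
    have hn : (1 / 12 : ℝ).toNNReal ≠ 0 := by simp
    have : NullSingletonClass (gaussianReal 0 (1 / 12 : ℝ).toNNReal) := nullSingletonClass_gaussianReal hn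
    have h0 : (gaussianReal 0 (1 / 12 : ℝ).toNNReal) {0} = 0 := measure_singleton 0
    have hmi : Measurable fun z => gaussianPair |(t : ℝ) - s| z i := (measurable_pi_apply i).comp hm
    rw [← h, Measure.map_apply hmi (measurableSet_singleton 0)] at h0
    exact h0
  rw [Measure.map_apply hm (measurableSet_eq_fun (by fun_prop) (by fun_prop))]
  refine measure_mono_null (fun z hz => ?_) (measure_union_null (hcoord 0) (hcoord 1))
  simp only [Set.mem_preimage, Set.mem_ofPred_eq, mul_eq_zero] at hz
  exact hz

lemma spinCorrelation_eq {L : ℕ} (x y : Fin L) : spinCorrelation L x y =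
    ∫ u, spinProduct (fun i => displacement L (scalePoints L u) (![x, y] i) / √L) ∂uniformSeq := by
  have hR : 0 < √(L : ℝ) := Real.sqrt_pos.2 (by exact_mod_cast x.pos)
  have hd := aemeasurable_displacement L
  rw [spinCorrelation, ← map_scalePoints_uniformSeq, integral_map
    (measurable_scalePoints L).aemeasurable]
  · congr 1
    ext u
    simp [spinProduct, spin_div_pos hR]
  · rw [map_scalePoints_uniformSeq]
    exact ((measurable_spin.comp_aemeasurable (hd x)).mul
      (measurable_spin.comp_aemeasurable (hd y))).aestronglyMeasurable

lemma tendsto_spinCorrelation_of_tendsto {N : ℕ → ℕ} (hN : Tendsto N atTop atTop)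
    {x y : ∀ n, Fin (N n)} {s t : unitInterval}
    (hx : Tendsto (fun n => ((x n : ℕ) : ℝ) / (N n : ℝ)) atTop (𝓝 s))
    (hy : Tendsto (fun n => ((y n : ℕ) : ℝ) / (N n : ℝ)) atTop (𝓝 t))
    (h0 : 0 < |(t : ℝ) - s|) (h1 : |(t : ℝ) - s| < 1) :
    Tendsto (fun n => spinCorrelation (N n) (x n) (y n)) atTop (𝓝 (Gpbc |(t : ℝ) - s|)) := by
  simp_rw [spinCorrelation_eq]
  rw [← integral_spin_gaussianPair ⟨h0, h1⟩]
  refine tendsto_integral_spinProduct (Z := gaussianPair |(t : ℝ) - s|) ?_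
    (map_gaussianPair_null s t)
  have hclt := tendstoInDistribution_sawtooth_pair s t
    (measurable_gaussianPair |(t : ℝ) - s|).aemeasurable (map_sum_mul_gaussianPair s t)
  have hclt' : TendstoInDistribution (fun (n : ℕ) u (i : Fin 2) =>
      (√(N n : ℝ))⁻¹ * pointSum (N n) (sawtooth (![(s : ℝ), (t : ℝ)] i)) u) atTop
      (gaussianPair |(t : ℝ) - s|) (fun _ => uniformSeq) stdPair :=
    ⟨fun n => hclt.forall_aemeasurable (N n), hclt.aemeasurable_limit, hclt.tendsto.comp hN⟩
  refine tendstoInDistribution_of_tendstoInMeasure_sub _ _ hclt' ?_ fun n =>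
    aemeasurable_pi_lambda _ fun i =>
      (aemeasurable_comp_scalePoints (aemeasurable_displacement (N n) _)).div_const _
  refine tendstoInMeasure_of_real fun ε hε δ hδ => ?_
  filter_upwards [eventually_measureReal_not_displacementApprox hN hx (half_pos hε) (half_pos hδ),
    eventually_measureReal_not_displacementApprox hN hy (half_pos hε) (half_pos hδ)] with n h1 h2
  refine (measureReal_mono (s₂ := {u | ¬ DisplacementApprox (N n) u (x n) s (ε / 2 * √(N n))} ∪
    {u | ¬ DisplacementApprox (N n) u (y n) t (ε / 2 * √(N n))}) ?_).trans
    ((measureReal_union_le _ _).trans (by linarith))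
  intro u hu
  by_contra hcon
  simp only [Set.mem_union, Set.mem_ofPred_eq, not_or, not_not] at hcon hu
  refine absurd hu (not_le.2 (lt_of_le_of_lt ?_ (half_lt_self hε)))
  have hR : 0 < √(N n : ℝ) := Real.sqrt_pos.2 (by exact_mod_cast (x n).pos)
  refine (pi_norm_le_iff_of_nonneg (half_pos hε).le).2 fun i => ?_
  simp only [Pi.sub_apply]
  rw [inv_mul_eq_div, ← sub_div, Real.norm_eq_abs, abs_div, abs_of_pos hR, div_le_iff₀ hR]
  fin_cases i
  · exact hcon.1.displacement
  · exact hcon.2.displacement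

lemma Gpbc_congr {σ τ : ℝ} (h : σ * (1 - σ) = τ * (1 - τ)) : Gpbc σ = Gpbc τ := by
  have e1 : 6 * σ * (1 - σ) = 6 * τ * (1 - τ) := by linarith
  have e2 : 12 * σ * (1 - σ) = 12 * τ * (1 - τ) := by linarith
  have e3 : 3 * σ * (1 - σ) = 3 * τ * (1 - τ) := by linarith
  rw [Gpbc, Gpbc, e1, e2, e3]

/-- The ratio of the distance of the indices to the number of points. -/
def indexGap (L : ℕ) (x y : Fin L) : ℝ := |((y : ℕ) : ℝ) - ((x : ℕ) : ℝ)| / L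

/-- Positions need not converge, but by compactness every subsequence has a further one along which
they do. The limit does not depend on the choice, since `Gpbc` depends on `τ` only through `τ (1 -
τ)`; this form of the hypothesis also treats both arcs between two points alike. -/
lemma tendsto_spinCorrelation_of_gap {τ : ℝ} (hτ : τ ∈ Set.Ioo (0 : ℝ) 1) {N : ℕ → ℕ}
    (hN : Tendsto N atTop atTop) {x y : ∀ n, Fin (N n)}
    (h : Tendsto (fun n => indexGap (N n) (x n) (y n) * (1 - indexGap (N n) (x n) (y n))) atTop
      (𝓝 (τ * (1 - τ)))) :
    Tendsto (fun n => spinCorrelation (N n) (x n) (y n)) atTop (𝓝 (Gpbc τ)) := by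
  refine tendsto_of_subseq_tendsto fun ns hns => ?_
  let q : ℕ → unitInterval × unitInterval := fun n =>
    (gridPoint (N (ns n)) (x (ns n)), gridPoint (N (ns n)) (y (ns n)))
  obtain ⟨⟨s, t⟩, -, ms, hms, hlim⟩ := isCompact_univ.tendsto_subseq (x := q) fun n => Set.mem_univ _
  refine ⟨ms, ?_⟩
  have hsub : Tendsto (fun n => ns (ms n)) atTop atTop := hns.comp hms.tendsto_atTop
  have hx : Tendsto (fun n => ((x (ns (ms n)) : ℕ) : ℝ) / (N (ns (ms n)) : ℝ)) atTop (𝓝 (s : ℝ)) :=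
    (continuous_subtype_val.tendsto s).comp ((continuous_fst.tendsto (s, t)).comp hlim)
  have hy : Tendsto (fun n => ((y (ns (ms n)) : ℕ) : ℝ) / (N (ns (ms n)) : ℝ)) atTop (𝓝 (t : ℝ)) :=
    (continuous_subtype_val.tendsto t).comp ((continuous_snd.tendsto (s, t)).comp hlim)
  have hgap : Tendsto (fun n => indexGap (N (ns (ms n))) (x (ns (ms n))) (y (ns (ms n)))) atTop
      (𝓝 |(t : ℝ) - s|) := by
    refine ((hy.sub hx).abs).congr fun n => ?_
    rw [← sub_div, abs_div, Nat.abs_cast, indexGap]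
  have heq : |(t : ℝ) - s| * (1 - |(t : ℝ) - s|) = τ * (1 - τ) :=
    tendsto_nhds_unique (hgap.mul (tendsto_const_nhds.sub hgap)) (h.comp hsub)
  have hpos : 0 < |(t : ℝ) - s| * (1 - |(t : ℝ) - s|) := by
    rw [heq]; exact mul_pos hτ.1 (by linarith [hτ.2])
  have h0 : 0 < |(t : ℝ) - s| := lt_of_le_of_ne (abs_nonneg _) fun h => by
    rw [← h] at hpos; simp at hpos
  have h1 : |(t : ℝ) - s| < 1 := by
    have := (mul_pos_iff_of_pos_left h0).1 hpos
    linarith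
  rw [← Gpbc_congr heq]
  exact tendsto_spinCorrelation_of_tendsto (hN.comp hsub) hx hy h0 h1

/-- The convergence of the two-point function is uniform in the pair of points. -/
theorem exists_abs_spinCorrelation_sub_le {τ : ℝ} (hτ : τ ∈ Set.Ioo (0 : ℝ) 1) {ε : ℝ}
    (hε : 0 < ε) : ∃ η > 0, ∃ L₀ : ℕ, ∀ L ≥ L₀, ∀ x y : Fin L,
      |indexGap L x y * (1 - indexGap L x y) - τ * (1 - τ)| ≤ η →
        |spinCorrelation L x y - Gpbc τ| ≤ ε := by
  by_contra hcon
  push Not at hcon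
  -- Failure of uniformity yields one sequence of bad pairs, with sizes tending to infinity and gaps
  -- converging, which contradicts the sequential statement.
  choose N hN x y hxy herr using fun n : ℕ => hcon (1 / ((n : ℝ) + 1)) (by positivity) n
  have hNtop : Tendsto N atTop atTop := tendsto_atTop_mono hN tendsto_id
  have hlim : Tendsto (fun n => indexGap (N n) (x n) (y n) * (1 - indexGap (N n) (x n) (y n))) atTop
      (𝓝 (τ * (1 - τ))) := by
    rw [tendsto_iff_dist_tendsto_zero]
    exact squeeze_zero (fun n => dist_nonneg) (fun n => by rw [Real.dist_eq]; exact hxy n)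
      tendsto_one_div_add_atTop_nhds_zero_nat
  have h := Metric.tendsto_nhds.1 (tendsto_spinCorrelation_of_gap hτ hNtop hlim) ε hε
  obtain ⟨n, hn⟩ := h.exists
  exact absurd hn (not_lt.2 (by rw [Real.dist_eq]; exact (herr n).le))

theorem tendsto_spinCorrelation {τ : ℝ} (hτ : τ ∈ Set.Ioo (0 : ℝ) 1) {L : ℕ → ℕ}
    {x y : ∀ n, Fin (L n)} (hL : Tendsto L atTop atTop)
    (h : Tendsto (fun n => |((y n : ℕ) : ℝ) - ((x n : ℕ) : ℝ)| / (L n : ℝ)) atTop (𝓝 τ)) :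
    Tendsto (fun n => spinCorrelation (L n) (x n) (y n)) atTop (𝓝 (Gpbc τ)) :=
  tendsto_spinCorrelation_of_gap hτ hL (h.mul (tendsto_const_nhds.sub h))

/-! ### The averaged two-point function -/

lemma mem_pairsAtDist {L r : ℕ} {q : Fin L × Fin L} :
    q ∈ pairsAtDist L r ↔ circDist L (redPoint L q.1) (redPoint L q.2) = r := by
  simp [pairsAtDist]

/-- The index difference is `r` or `L - r` in absolute value, and the product is symmetric under
exchanging these. -/
lemma indexGap_of_mem_pairsAtDist {L r : ℕ} (hr : 2 * r ≤ L) {q : Fin L × Fin L}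
    (hq : q ∈ pairsAtDist L r) :
    indexGap L q.1 q.2 * (1 - indexGap L q.1 q.2) = (r : ℝ) / L * (1 - (r : ℝ) / L) := by
  have hL : (0 : ℝ) < L := by exact_mod_cast q.1.pos
  have hr' : 2 * (r : ℝ) ≤ L := by exact_mod_cast hr
  have hr0 : (0 : ℝ) ≤ r := Nat.cast_nonneg r
  rw [mem_pairsAtDist, circDist_eq_abs, circDisplacement] at hq
  set k := round ((L : ℝ)⁻¹ * (redPoint L q.2 - redPoint L q.1))
  rw [show redPoint L q.2 - redPoint L q.1 = ((q.2 : ℕ) : ℝ) - ((q.1 : ℕ) : ℝ) by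
    simp only [redPoint]; ring] at hq
  have h1 : ((q.1 : ℕ) : ℝ) + 1 ≤ L := by exact_mod_cast q.1.isLt
  have h2 : ((q.2 : ℕ) : ℝ) + 1 ≤ L := by exact_mod_cast q.2.isLt
  have h1' : (0 : ℝ) ≤ (q.1 : ℕ) := Nat.cast_nonneg _
  have h2' : (0 : ℝ) ≤ (q.2 : ℕ) := Nat.cast_nonneg _
  have hd : |((q.2 : ℕ) : ℝ) - ((q.1 : ℕ) : ℝ)| = r ∨
      |((q.2 : ℕ) : ℝ) - ((q.1 : ℕ) : ℝ)| = L - r := by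
    set d := ((q.2 : ℕ) : ℝ) - ((q.1 : ℕ) : ℝ)
    have hd1 : d < L := by simp only [d]; linarith
    have hd2 : -(L : ℝ) < d := by simp only [d]; linarith
    have hkub : (k : ℝ) < 2 := by
      by_contra hk
      rw [not_lt] at hk
      have := mul_le_mul_of_nonneg_right hk hL.le
      rcases abs_eq hr0 |>.1 hq with h | h <;> linarith
    have hklb : -2 < (k : ℝ) := by
      by_contra hk
      rw [not_lt] at hk
      have := mul_le_mul_of_nonneg_right hk hL.le
      rcases abs_eq hr0 |>.1 hq with h | h <;> linarith
    have hk1 : k < 2 := by exact_mod_cast hkub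
    have hk2 : -2 < k := by exact_mod_cast hklb
    have hk3 : k = -1 ∨ k = 0 ∨ k = 1 := by omega
    rcases hk3 with hk | hk | hk
    · right
      rw [hk] at hq
      push_cast at hq
      rcases abs_eq hr0 |>.1 hq with h | h
      · rw [abs_of_nonpos (by linarith)]; linarith
      · linarith
    · left
      rw [hk] at hq
      simpa using hq
    · right
      rw [hk] at hq
      push_cast at hq
      rcases abs_eq hr0 |>.1 hq with h | h
      · linarith
      · rw [abs_of_nonneg (by linarith)]; linarith
  unfold indexGap
  rcases hd with h | h
  · rw [h]
  · rw [h, sub_div, div_self hL.ne']; ring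

/-- This ensures that the average is a genuine one and not the default value of a division by zero.
-/
lemma pairsAtDist_nonempty {L r : ℕ} (hL : 0 < L) (hr : 2 * r ≤ L) : (pairsAtDist L r).Nonempty := by
  refine ⟨(⟨0, hL⟩, ⟨r, by omega⟩), mem_pairsAtDist.2 ?_⟩
  have hL' : (0 : ℝ) < L := by exact_mod_cast hL
  have hr' : 2 * (r : ℝ) ≤ L := by exact_mod_cast hr
  have e : redPoint L ⟨r, by omega⟩ - redPoint L ⟨0, hL⟩ = r := by simp [redPoint]
  rw [circDist, e, (AddCircle.norm_coe_eq_abs_iff (L : ℝ) hL'.ne').2]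
  · simp
  · rw [Nat.abs_cast, Nat.abs_cast]; linarith

lemma abs_avgSpinCorrelation_sub_le {L r : ℕ} (hne : (pairsAtDist L r).Nonempty) {G ε : ℝ}
    (h : ∀ q ∈ pairsAtDist L r, |spinCorrelation L q.1 q.2 - G| ≤ ε) :
    |avgSpinCorrelation L r - G| ≤ ε := by
  have hc : (0 : ℝ) < (pairsAtDist L r).card := by exact_mod_cast hne.card_pos
  have e : avgSpinCorrelation L r - G =
      (∑ q ∈ pairsAtDist L r, (spinCorrelation L q.1 q.2 - G)) / (pairsAtDist L r).card := by
    rw [Finset.sum_sub_distrib, Finset.sum_const, nsmul_eq_mul, sub_div, avgSpinCorrelation,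
      mul_div_cancel_left₀ _ hc.ne']
  rw [e, abs_div, abs_of_pos hc, div_le_iff₀ hc]
  refine (Finset.abs_sum_le_sum_abs _ _).trans ((Finset.sum_le_sum h).trans_eq ?_)
  rw [Finset.sum_const, nsmul_eq_mul, mul_comm]

theorem tendsto_avgSpinCorrelation {τ : ℝ} (hτ : τ ∈ Set.Ioc (0 : ℝ) (1 / 2)) {L r : ℕ → ℕ}
    (hL : Tendsto L atTop atTop) (hr : ∀ n, 2 * r n ≤ L n)
    (h : Tendsto (fun n => (r n : ℝ) / (L n : ℝ)) atTop (𝓝 τ)) :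
    Tendsto (fun n => avgSpinCorrelation (L n) (r n)) atTop (𝓝 (Gpbc τ)) := by
  have hτ' : τ ∈ Set.Ioo (0 : ℝ) 1 := ⟨hτ.1, by linarith [hτ.2]⟩
  rw [Metric.tendsto_nhds]
  intro ε hε
  obtain ⟨η, hη, L₀, key⟩ := exists_abs_spinCorrelation_sub_le hτ' (half_pos hε)
  have hlim := h.mul (tendsto_const_nhds (x := (1 : ℝ)).sub h)
  filter_upwards [Metric.tendsto_nhds.1 hlim η hη, hL.eventually_ge_atTop L₀,
    hL.eventually_gt_atTop 0] with n h1 h2 h3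
  rw [Real.dist_eq] at h1 ⊢
  refine lt_of_le_of_lt (abs_avgSpinCorrelation_sub_le (pairsAtDist_nonempty h3 (hr n))
    fun q hq => key _ h2 _ _ ?_) (half_lt_self hε)
  rw [indexGap_of_mem_pairsAtDist (hr n) hq]
  exact h1.le

end GridPoisson

end

open GridPoisson in
theorem mainTheorem2 :
    -- for every size, almost surely, the optimal matching is unique and is a cyclic shift
    (∀ L : ℕ, ∀ᵐ b ∂(blueLaw L),
      (∃! π : Equiv.Perm (Fin L), IsOptimalMatching L b π) ∧
      ∀ i j : Fin L, (j : ℤ) ≡ (i : ℤ) - optimalShift L b [ZMOD (L : ℤ)] →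
        optimalMatching L b j = Tuple.sort b i) ∧
    (∀ (Ω : Type*) [MeasurableSpace Ω] (μ : Measure Ω) [IsProbabilityMeasure μ]
      (B : unitInterval → Ω → ℝ), IsBrownianBridge B μ →
      -- the optimal shift of the bridge is its mean
      (∀ᵐ ω ∂μ, ∀ l : ℝ,
        (∀ l' : ℝ, shiftEnergy (fun s => B s ω) l ≤ shiftEnergy (fun s => B s ω) l') ↔
          l = pathMean fun s => B s ω) ∧
      -- joint convergence of the ordered displacements, the optimal shift and the displacements
      (∀ (k : ℕ) (s : Fin k → unitInterval),
        TendstoInDistribution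
          (fun (L : ℕ) (b : Fin L → ℝ) =>
            ((fun m : Fin k => rescale L (orderedDisplacement L b) (s m)),
              scaledShift L b,
              (fun m : Fin k => rescale L (displacement L b) (s m))))
          atTop
          (fun ω => ((fun m : Fin k => B (s m) ω),
            (pathMean fun u => B u ω),
            (fun m : Fin k => centredProcess B (s m) ω)))
          blueLaw μ) ∧
      -- the limit process is a centred Gaussian process with the stated covariance
      IsGaussianProcess (centredProcess B) μ ∧
      (∀ s, ∫ ω, centredProcess B s ω ∂μ = 0) ∧
      (∀ s t : unitInterval, cov[centredProcess B s, centredProcess B t; μ] =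
        1 / 12 - |(t : ℝ) - s| * (1 - |(t : ℝ) - s|) / 2) ∧
      -- the correlation of its signs
      (∀ s t : unitInterval, 0 < |(t : ℝ) - s| → |(t : ℝ) - s| < 1 →
        ∫ ω, spin (centredProcess B s ω) * spin (centredProcess B t ω) ∂μ =
          Gpbc |(t : ℝ) - s|)) ∧
    -- the two-point function of the spins converges to `Gpbc`
    (∀ τ ∈ Set.Ioo (0 : ℝ) 1, ∀ (L : ℕ → ℕ) (x y : ∀ n, Fin (L n)),
      Tendsto L atTop atTop →
      Tendsto (fun n => |((y n : ℕ) : ℝ) - ((x n : ℕ) : ℝ)| / (L n : ℝ)) atTop (𝓝 τ) →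
      Tendsto (fun n => spinCorrelation (L n) (x n) (y n)) atTop (𝓝 (Gpbc τ))) ∧
    -- so does its average over the pairs of points at a given distance
    (∀ τ ∈ Set.Ioc (0 : ℝ) (1 / 2), ∀ L r : ℕ → ℕ,
      Tendsto L atTop atTop → (∀ n, 2 * r n ≤ L n) →
      Tendsto (fun n => (r n : ℝ) / (L n : ℝ)) atTop (𝓝 τ) →
      Tendsto (fun n => avgSpinCorrelation (L n) (r n)) atTop (𝓝 (Gpbc τ))) ∧
    -- the zeros of `Gpbc`
    (∀ τ ∈ Set.Ioo (0 : ℝ) 1,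
      Gpbc τ = 0 ↔ τ = (3 - √3) / 6 ∨ τ = 1 - (3 - √3) / 6) := by
  refine ⟨ae_optimalMatching_cyclic, ?_, ?_, ?_, ?_⟩
  · intro Ω _ μ _ B hB
    refine ⟨?_, hB.tendstoInDistribution, hB.isGaussianProcess_centredProcess,
      fun s => integral_eq_zero_of_map_gaussianReal (hB.aemeasurable_centredProcess s)
        (hB.map_centredProcess s),
      hB.covariance_centredProcess, fun s t h0 h1 => hB.integral_spin_centredProcess h0 h1⟩
    filter_upwards [hB.continuous_paths] with ω hω l using forall_shiftEnergy_le_iff hω l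
  · exact fun τ hτ L x y hL h => tendsto_spinCorrelation hτ hL h
  · exact fun τ hτ L r hL hr h => tendsto_avgSpinCorrelation hτ hL hr h
  · exact fun τ hτ => Gpbc_eq_zero_iff hτ
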